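/- **Setting.** Let $d\ge 1$, $p\in\mathbb N$, $\theta_{inf}<\theta_{sup}$ and $\Theta=[\theta_{inf},\theta_{sup}]^p$. Let $\{K_\theta:\mathbb R^d\to\mathbb R,\ \theta\in\Theta\}$ be a family of stationary covariance functions such that: * for every $t$, $\theta\mapsto K_\theta(t)$ is three times differentiable on $\Theta$, and for all $q\in\{0,\dots,3\}$ and $i_1,\dots,i_q\in\{1,\dots,p\}$ there is $C_{i_1,\dots,i_q}<\infty$ with $\left|\frac{\partial}{\partial\theta_{i_1}}\cdots\frac{\partial}{\partial\theta_{i_q}}K_\theta(t)\right|\le \frac{C_{i_1,\dots,i_q}}{1+|t|^{d+1}}$ for all $\theta\in\Theta$, $t\in\mathbb R^d$, where $|t|$ is the Euclidean norm (derivatives are one-sided on the faces of $\Theta$); * with $\hat K_\theta(f)=(2\pi)^{-d}\int_{\mathbb R^d}K_\theta(t)e^{-\mathrm i f\cdot t}\,dt$, the function $\hat K_\theta$ is integrable and $K_\theta(t)=\int_{\mathbb R^d}\hat K_\theta(f)e^{\mathrm i f\cdot t}\,df$ for all $\theta\in\Theta$, $t\in\mathbb R^d$; and $(f,\theta)\mapsto\hat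 K_\theta(f)$ is real-valued, continuous and positive on $\mathbb R^d\times\Theta$. Let $\mathcal L_X$ be a probability distribution on $\mathbb R^d$ that is symmetric ($-X\sim\mathcal L_X$ if $X\sim \mathcal L_X$), whose support $S_X$ is contained in $[-1,1]^d$ and which has a probability density function that is positive on $S_X$. Let $(v_i)_{i\ge1}$ be a sequence in $\{1,2,\dots\}^d$ with $\{v_i: 1\le i\le N^d\}=\{1,\dots,N\}^d$ for all $N\ge1$, and let $\epsilon\in[0,\frac12)$. For $x=(x_1,\dots,x_n)\in (S_X)^n$ let $R_\theta$ be the $n\times n$ matrix with entries $(R_\theta)_{i,j}=K_\theta\left(v_i-v_j+\epsilon(x_i-x_j)\right)$; it becomes a random matrix when $x$ is replaced by $X=(X_1,\dots,X_n)$, where $(X_i)_{i\ge1}$ are i.i.d. with distribution $\mathcal L_X$. For a square matrix $A$, $\mathrm{diag}(A)$ is the matrix obtained from $A$ by setting all off-diagonal entries to $0$. Let $S_p=\bigcup_{k=0}^3\{1,\dots,p\}^k$ and $S_{nd}=S_p\cup\{-1\}$. For $I=(i_1,\dots,i_k)\in S_p$ put $R_\theta^I=\frac{\partial}{\partial\theta_{i_1}}\cdots\frac{\partial}{\partial\theta_{i_k}}R_\theta$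 (so $R_\theta^{I}=R_\theta$ for $k=0$), and put $R_\theta^{-1}$ for the inverse matrix when $I=-1$. Consider the matrices * $M_{nd}^I=R_\theta^I$ for $I\in S_{nd}$; * $M_{sd}^1=\mathrm{diag}(R_\theta^{-1})^{-1}$; * $M_{bd}^I=\mathrm{diag}\left(R_\theta^{I_1}\cdots R_\theta^{I_m}\right)$ for $I=(I_1,\dots,I_m)\in S_{nd}^m$, $m\ge1$. Let $\mathcal M_\theta$ be the set of all (sequences in $n$ of) products $M_{d_1}^{I_1}\cdots M_{d_k}^{I_k}$, $k\ge1$, of such matrices for which, for each factor with $d_j=bd$, the product matrix inside $\mathrm{diag}$ is symmetric (for all $n$ and all $x\in (S_X)^n$). **Proposition.** 1. For every choice of labels $(d_1,I_1),\dots,(d_k,I_k)$, the singular values of $M_{d_1}^{I_1}\cdots M_{d_k}^{I_k}$ are bounded uniformly in $n$, in $x\in(S_X)^n$ and in those $\theta\in\Theta$ for which the product belongs to $\mathcal M_\theta$. 2. For $\theta\in\Theta$ and $M_{d_1}^{I_1}\cdots M_{d_k}^{I_k}\in\mathcal M_\theta$ let $S_n=\frac1n\mathrm{Tr}\left(M_{d_1}^{I_1}\cdots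 M_{d_k}^{I_k}\right)$, evaluated at $x=X$. Then, for the given family $\{K_\theta\}$ and law $\mathcal L_X$, there is a deterministic $S\in\mathbb R$, depending only on $\epsilon$, $\theta$ and $(d_1,I_1),\dots,(d_k,I_k)$ (not on the enumeration $(v_i)$ nor on the realization of the $X_i$), such that $S_n\to S$ almost surely as $n\to\infty$. Moreover the $S_n$ are square-integrable, $S_n\to S$ in quadratic mean, and $\mathrm{var}(S_n)\to0$ as $n\to\infty$. -/

import Mathlib

open MeasureTheory ProbabilityTheory Filter Topology

noncomputable section

namespace PerturbedGrid

/-- The parameter set `Θ = [a, b]^p`. -/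
def paramSet (p : ℕ) (a b : ℝ) : Set (Fin p → ℝ) :=
  {θ | ∀ i, θ i ∈ Set.Icc a b}

/-- Partial derivative `∂f/∂θ_i` on the cube `[a, b]^p` (one-sided on the faces `θ_i = a` and
`θ_i = b`). -/
def partialDeriv {p : ℕ} (a b : ℝ) (i : Fin p) (f : (Fin p → ℝ) → ℝ) (θ : Fin p → ℝ) : ℝ :=
  derivWithin (fun s : ℝ => f (Function.update θ i s)) (Set.Icc a b) (θ i)

/-- Iterated partial derivative `∂/∂θ_{i_1} ... ∂/∂θ_{i_q} f` for `I = [i_1, ..., i_q]`; for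
`I = []` this is `f`. -/
def iterPartial {p : ℕ} (a b : ℝ) (I : List (Fin p)) (f : (Fin p → ℝ) → ℝ) :
    (Fin p → ℝ) → ℝ :=
  I.foldr (partialDeriv a b) f

/-- `k` is the covariance function `(s, t) ↦ k (s - t)` of a real stationary process on `ℝ^d`. -/
def IsStationaryCovariance {d : ℕ} (k : EuclideanSpace ℝ (Fin d) → ℝ) : Prop :=
  (∀ t, k (-t) = k t) ∧
    ∀ (s : Finset (EuclideanSpace ℝ (Fin d))) (c : EuclideanSpace ℝ (Fin d) → ℝ),
      0 ≤ ∑ t ∈ s, ∑ u ∈ s, c t * c u * k (t - u)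

/-- The Fourier transform `ĥ(f) = (2π)^{-d} ∫ h(t) e^{-i f·t} dt`. -/
def fourierHat {d : ℕ} (h : EuclideanSpace ℝ (Fin d) → ℝ) (f : EuclideanSpace ℝ (Fin d)) : ℂ :=
  (((2 * Real.pi) ^ d)⁻¹ : ℝ) *
    ∫ t : EuclideanSpace ℝ (Fin d), (h t : ℂ) * Complex.exp (-(Complex.I * (inner ℝ f t : ℝ)))

/-- The regularity condition on the parametric model `{K_θ, θ ∈ [a, b]^p}`. -/
structure ModelCondition {d p : ℕ} (a b : ℝ)
    (K : (Fin p → ℝ) → EuclideanSpace ℝ (Fin d) → ℝ) : Prop where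
  /-- Each `K_θ` is a stationary covariance function. -/
  stationary : ∀ θ ∈ paramSet p a b, IsStationaryCovariance (K θ)
  /-- `K_θ(t)` is three times differentiable in `θ`: it and all its partial derivatives of
  order at most two are differentiable on the cube. -/
  differentiable : ∀ I : List (Fin p), I.length ≤ 2 → ∀ t,
    DifferentiableOn ℝ (iterPartial a b I (fun θ => K θ t)) (paramSet p a b)
  /-- Polynomial decay of `K_θ` and of its derivatives up to order three, uniform in `θ`. -/
  decay : ∀ I : List (Fin p), I.length ≤ 3 → ∃ C : ℝ, ∀ θ ∈ paramSet p a b, ∀ t,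
    |iterPartial a b I (fun θ' => K θ' t) θ| ≤ C / (1 + ‖t‖ ^ (d + 1))
  /-- Fourier inversion holds (with an absolutely convergent integral). -/
  integrable_hat : ∀ θ ∈ paramSet p a b, Integrable (fourierHat (K θ))
  inversion : ∀ θ ∈ paramSet p a b, ∀ t, (K θ t : ℂ) =
    ∫ f : EuclideanSpace ℝ (Fin d),
      fourierHat (K θ) f * Complex.exp (Complex.I * (inner ℝ f t : ℝ))
  /-- `(f, θ) ↦ K̂_θ(f)` is continuous on `ℝ^d × Θ`, with positive real values. -/
  continuous_hat : ContinuousOn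
    (fun q : EuclideanSpace ℝ (Fin d) × (Fin p → ℝ) => fourierHat (K q.2) q.1)
    (Set.univ ×ˢ paramSet p a b)
  positive_hat : ∀ θ ∈ paramSet p a b, ∀ f,
    (fourierHat (K θ) f).im = 0 ∧ 0 < (fourierHat (K θ) f).re

/-- `v` (indexed from `0`) is a sequence of points of `(ℕ*)^d` whose first `N^d` terms are exactly
the points of `{1, ..., N}^d`, for every `N ≥ 1`. -/
def IsGridSequence {d : ℕ} (v : ℕ → Fin d → ℕ) : Prop :=
  ∀ N : ℕ, 1 ≤ N → v '' {i | i < N ^ d} = {u | ∀ k, 1 ≤ u k ∧ u k ≤ N}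

/-- `μ` is a symmetric probability distribution on `ℝ^d` whose support is contained in
`[-1, 1]^d` and which has a probability density function that is positive on its support. -/
structure IsPerturbationLaw {d : ℕ} (μ : Measure (EuclideanSpace ℝ (Fin d))) : Prop where
  isProbability : IsProbabilityMeasure μ
  symmetric : μ.map (fun x => -x) = μ
  support_subset : ∀ x ∈ μ.support, ∀ k, |x k| ≤ 1
  density : ∃ g : EuclideanSpace ℝ (Fin d) → ENNReal, Measurable g ∧
    μ = volume.withDensity g ∧ ∀ x ∈ μ.support, 0 < g x

/-- The `i`-th observation point `v_i + ε x_i`. -/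
def obsPoint {d n : ℕ} (v : ℕ → Fin d → ℕ) (ε : ℝ) (x : Fin n → EuclideanSpace ℝ (Fin d))
    (i : Fin n) : EuclideanSpace ℝ (Fin d) :=
  WithLp.toLp 2 (fun k => (v i k : ℝ)) + ε • x i

/-- The covariance matrix `R_θ`, with entries `K_θ(v_i - v_j + ε (x_i - x_j))`. -/
def covMatrix {d p n : ℕ} (K : (Fin p → ℝ) → EuclideanSpace ℝ (Fin d) → ℝ)
    (v : ℕ → Fin d → ℕ) (ε : ℝ) (x : Fin n → EuclideanSpace ℝ (Fin d)) (θ : Fin p → ℝ) :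
    Matrix (Fin n) (Fin n) ℝ :=
  Matrix.of fun i j => K θ (obsPoint v ε x i - obsPoint v ε x j)

/-- `diag A`: all off-diagonal entries of `A` are replaced by `0`. -/
def diagPart {n : ℕ} (A : Matrix (Fin n) (Fin n) ℝ) : Matrix (Fin n) (Fin n) ℝ :=
  Matrix.diagonal fun i => A i i

/-- The index set `S_nd = S_p ∪ {-1}`, where `S_p` is the set of multi-indices of length at most
three with entries in `{1, ..., p}`. -/
inductive NdIndex (p : ℕ) where
  | deriv (I : List (Fin p)) (hI : I.length ≤ 3)
  | inv

/-- The labels `(nd, I)`, `(sd, 1)` and `(bd, I)` of the factors. -/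
inductive FactorLabel (p : ℕ) where
  | nd (I : NdIndex p)
  | sd
  | bd (L : List (NdIndex p))

/-- The matrix `R_θ^I`: an entrywise partial derivative of `R_θ`, or the inverse of `R_θ`. -/
def ndMatrix {d p n : ℕ} (a b : ℝ) (K : (Fin p → ℝ) → EuclideanSpace ℝ (Fin d) → ℝ)
    (v : ℕ → Fin d → ℕ) (ε : ℝ) (x : Fin n → EuclideanSpace ℝ (Fin d)) (θ : Fin p → ℝ) :
    NdIndex p → Matrix (Fin n) (Fin n) ℝ
  | .deriv I _ => Matrix.of fun i j => iterPartial a b I (fun θ' => covMatrix K v ε x θ' i j) θ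
  | .inv => (covMatrix K v ε x θ)⁻¹

/-- The product `R_θ^{I_1} ... R_θ^{I_m}` for `L = [I_1, ..., I_m]`. -/
def ndProduct {d p n : ℕ} (a b : ℝ) (K : (Fin p → ℝ) → EuclideanSpace ℝ (Fin d) → ℝ)
    (v : ℕ → Fin d → ℕ) (ε : ℝ) (x : Fin n → EuclideanSpace ℝ (Fin d)) (θ : Fin p → ℝ)
    (L : List (NdIndex p)) : Matrix (Fin n) (Fin n) ℝ :=
  (L.map (ndMatrix a b K v ε x θ)).prod

/-- The matrices `M_nd^I = R_θ^I`, `M_sd^1 = diag(R_θ⁻¹)⁻¹` and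
`M_bd^I = diag(R_θ^{I_1} ... R_θ^{I_m})`. -/
def factorMatrix {d p n : ℕ} (a b : ℝ) (K : (Fin p → ℝ) → EuclideanSpace ℝ (Fin d) → ℝ)
    (v : ℕ → Fin d → ℕ) (ε : ℝ) (x : Fin n → EuclideanSpace ℝ (Fin d)) (θ : Fin p → ℝ) :
    FactorLabel p → Matrix (Fin n) (Fin n) ℝ
  | .nd I => ndMatrix a b K v ε x θ I
  | .sd => (diagPart (covMatrix K v ε x θ)⁻¹)⁻¹
  | .bd L => diagPart (ndProduct a b K v ε x θ L)

/-- The product `M_{d_1}^{I_1} ... M_{d_K}^{I_K}` described by the list `w` of labels. -/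
def wordMatrix {d p n : ℕ} (a b : ℝ) (K : (Fin p → ℝ) → EuclideanSpace ℝ (Fin d) → ℝ)
    (v : ℕ → Fin d → ℕ) (ε : ℝ) (x : Fin n → EuclideanSpace ℝ (Fin d)) (θ : Fin p → ℝ)
    (w : List (FactorLabel p)) : Matrix (Fin n) (Fin n) ℝ :=
  (w.map (factorMatrix a b K v ε x θ)).prod

/-- The label list `w` describes an element of the class `𝓜_θ`: it is non-empty, and for each of its
factors `diag(R_θ^{I_1} ... R_θ^{I_m})` one has `m ≥ 1` and the matrix `R_θ^{I_1} ... R_θ^{I_m}` is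
symmetric for all `n` and all `x ∈ S^n`. -/
def MemClass {d p : ℕ} (a b : ℝ) (K : (Fin p → ℝ) → EuclideanSpace ℝ (Fin d) → ℝ)
    (v : ℕ → Fin d → ℕ) (ε : ℝ) (S : Set (EuclideanSpace ℝ (Fin d))) (θ : Fin p → ℝ)
    (w : List (FactorLabel p)) : Prop :=
  w ≠ [] ∧ ∀ L : List (NdIndex p), FactorLabel.bd L ∈ w →
    L ≠ [] ∧ ∀ (n : ℕ) (x : Fin n → EuclideanSpace ℝ (Fin d)), (∀ i, x i ∈ S) →
      (ndProduct a b K v ε x θ L).IsSymm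

/-- The normalized trace `(1/n) Tr(M_{d_1}^{I_1} ... M_{d_K}^{I_K})`. -/
def normTrace {d p n : ℕ} (a b : ℝ) (K : (Fin p → ℝ) → EuclideanSpace ℝ (Fin d) → ℝ)
    (v : ℕ → Fin d → ℕ) (ε : ℝ) (x : Fin n → EuclideanSpace ℝ (Fin d)) (θ : Fin p → ℝ)
    (w : List (FactorLabel p)) : ℝ :=
  (1 / (n : ℝ)) * (wordMatrix a b K v ε x θ w).trace

end PerturbedGrid

end

/-!
Two observation points with grid positions `u` and `v` are at distance at least `(1 - 2 ε) ‖u - v‖`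
in the sup norm, so the entries of the covariance matrix and of its derivatives are dominated by a
summable weight of `u - v`: Schur's test bounds these matrices uniformly in `n`. Since the spectral
density is positive and jointly continuous, the quadratic form of the covariance matrix is bounded
below uniformly (compare with the cosine transform of a dilated bump function, which is nearly
diagonal on separated points), and this bounds the inverse and the diagonal parts.

For the traces, cut the box `{0, ..., k L - 1}^d` into `k ^ d` blocks of side `L` and set to zero
the covariances between different blocks. In trace norm this moves the covariance matrix, its
derivatives and, by boundedness and coercivity, every product of factors by at most a fraction of
the number of points that vanishes as `L → ∞`. The trace thereby becomes a sum of independent,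
identically distributed block traces, to which the strong law of large numbers applies for each
fixed `L`; letting `L → ∞` gives the limit. A number `n` of points that is not the size of such a
box is reduced to one by deleting `o(n)` points, which changes the trace by `o(n)`. As the
normalized traces are bounded, almost sure convergence upgrades to convergence in quadratic mean.
-/

noncomputable section

namespace PerturbedGrid

open scoped Matrix.Norms.L2Operator
open Matrix

universe u v

section OperatorNorm

variable {m n : Type*} [Fintype m] [Fintype n]

theorem norm_toLp_sq (x : n → ℝ) : ‖WithLp.toLp 2 x‖ ^ 2 = x ⬝ᵥ x := by
  rw [EuclideanSpace.real_norm_sq_eq]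
  simp only [dotProduct, sq]

theorem dotProduct_self_nonneg (x : n → ℝ) : 0 ≤ x ⬝ᵥ x :=
  Finset.sum_nonneg fun _ _ => mul_self_nonneg _

theorem sq_mulVec_apply_le_of_row_sum {ι : Type*} {A : Matrix ι n ℝ} {C : ℝ}
    (hrow : ∀ i, ∑ j, |A i j| ≤ C) (x : n → ℝ) (i : ι) :
    (A *ᵥ x) i * (A *ᵥ x) i ≤ C * ∑ j, |A i j| * (x j * x j) := by
  have hweighted : ∀ j, 0 ≤ |A i j| * (x j * x j) := fun j =>
    mul_nonneg (abs_nonneg _) (mul_self_nonneg _)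
  calc (A *ᵥ x) i * (A *ᵥ x) i ≤ (∑ j, |A i j|) * ∑ j, |A i j| * (x j * x j) := by
        rw [← sq]
        refine Finset.sum_sq_le_sum_mul_sum_of_sq_le_mul Finset.univ (fun _ _ => abs_nonneg _)
          (fun j _ => hweighted j) fun j _ => ?_
        rw [mul_pow, ← sq_abs (A i j)]
        exact le_of_eq (by ring)
    _ ≤ C * ∑ j, |A i j| * (x j * x j) :=
        mul_le_mul_of_nonneg_right (hrow i) (Finset.sum_nonneg fun j _ => hweighted j)

variable [DecidableEq n]

theorem l2_opNorm_le_iff {A : Matrix m n ℝ} {C : ℝ} (hC : 0 ≤ C) :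
    ‖A‖ ≤ C ↔ ∀ x, (A *ᵥ x) ⬝ᵥ (A *ᵥ x) ≤ C ^ 2 * (x ⬝ᵥ x) := by
  simp only [← norm_toLp_sq, ← mul_pow]
  refine ⟨fun h x => ?_, fun h => ?_⟩
  · gcongr
    exact (l2_opNorm_mulVec A (WithLp.toLp 2 x)).trans (by gcongr)
  · rw [l2_opNorm_def]
    exact ContinuousLinearMap.opNorm_le_bound _ hC fun x =>
      le_of_sq_le_sq (h x.ofLp) (by positivity)

theorem abs_apply_le_l2_opNorm (A : Matrix m n ℝ) (i : m) (j : n) : |A i j| ≤ ‖A‖ := by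
  have hcol := (l2_opNorm_le_iff (norm_nonneg A)).1 le_rfl (Pi.single j 1)
  simp only [mulVec_single_one, dotProduct_single, Pi.single_eq_same, mul_one] at hcol
  refine abs_le_of_sq_le_sq (le_trans ?_ hcol) (norm_nonneg _)
  rw [sq]
  exact Finset.single_le_sum (f := fun k => A k j * A k j) (fun _ _ => mul_self_nonneg _)
    (Finset.mem_univ i)

theorem l2_opNorm_diagonal_diag_le (A : Matrix n n ℝ) : ‖diagonal A.diag‖ ≤ ‖A‖ := by
  rw [l2_opNorm_diagonal]
  exact (pi_norm_le_iff_of_nonneg (norm_nonneg A)).2 fun i => abs_apply_le_l2_opNorm A i i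

theorem l2_opNorm_one_le : ‖(1 : Matrix n n ℝ)‖ ≤ 1 :=
  (l2_opNorm_le_iff zero_le_one).2 fun x => by simp

theorem abs_trace_le_card_mul_l2_opNorm (A : Matrix n n ℝ) :
    |A.trace| ≤ Fintype.card n * ‖A‖ := by
  refine (Finset.abs_sum_le_sum_abs _ _).trans ?_
  refine (Finset.sum_le_card_nsmul _ _ ‖A‖ fun i _ => abs_apply_le_l2_opNorm A i i).trans ?_
  rw [nsmul_eq_mul, Finset.card_univ]

theorem l2_opNorm_le_of_row_col_sum {A : Matrix m n ℝ} {C : ℝ} (hC : 0 ≤ C)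
    (hrow : ∀ i, ∑ j, |A i j| ≤ C) (hcol : ∀ j, ∑ i, |A i j| ≤ C) : ‖A‖ ≤ C := by
  refine (l2_opNorm_le_iff hC).2 fun x => ?_
  calc (A *ᵥ x) ⬝ᵥ (A *ᵥ x) ≤ ∑ i, C * ∑ j, |A i j| * (x j * x j) :=
        Finset.sum_le_sum fun i _ => sq_mulVec_apply_le_of_row_sum hrow x i
    _ = C * ∑ j, (∑ i, |A i j|) * (x j * x j) := by
        rw [← Finset.mul_sum, Finset.sum_comm]
        simp_rw [Finset.sum_mul]
    _ ≤ C * ∑ j, C * (x j * x j) := by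
        gcongr with j _
        exacts [mul_self_nonneg _, hcol j]
    _ = C ^ 2 * (x ⬝ᵥ x) := by
        rw [← Finset.mul_sum, dotProduct]
        ring

end OperatorNorm

section PrincipalSubmatrix

variable {ι κ : Type*} [Fintype ι] [Fintype κ] {f : κ → ι}

theorem dotProduct_extend_zero (hf : f.Injective) (y : ι → ℝ) (x : κ → ℝ) :
    y ⬝ᵥ Function.extend f x 0 = (y ∘ f) ⬝ᵥ x :=
  (Fintype.sum_of_injective f hf _ _
    (fun i hi => by simp [Function.extend_apply' _ _ _ hi])
    fun k => by simp [hf.extend_apply]).symm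

theorem submatrix_mulVec_eq_mulVec_extend (hf : f.Injective) (A : Matrix ι ι ℝ) (x : κ → ℝ) :
    A.submatrix f f *ᵥ x = (A *ᵥ Function.extend f x 0) ∘ f :=
  funext fun k => (dotProduct_extend_zero hf (A (f k)) x).symm

theorem dotProduct_extend_zero_self (hf : f.Injective) (x : κ → ℝ) :
    Function.extend f x 0 ⬝ᵥ Function.extend f x 0 = x ⬝ᵥ x := by
  rw [dotProduct_extend_zero hf, Function.extend_comp hf]

theorem dotProduct_comp_self_le (hf : f.Injective) (y : ι → ℝ) : (y ∘ f) ⬝ᵥ (y ∘ f) ≤ y ⬝ᵥ y := by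
  classical
  exact (Finset.sum_image (f := fun i => y i * y i) hf.injOn).symm.trans_le
    (Finset.sum_le_univ_sum_of_nonneg fun _ => mul_self_nonneg _)

variable [DecidableEq ι] [DecidableEq κ]

theorem l2_opNorm_submatrix_le (hf : f.Injective) (A : Matrix ι ι ℝ) :
    ‖A.submatrix f f‖ ≤ ‖A‖ := by
  refine (l2_opNorm_le_iff (norm_nonneg A)).2 fun x => ?_
  rw [submatrix_mulVec_eq_mulVec_extend hf, ← dotProduct_extend_zero_self hf x]
  exact (dotProduct_comp_self_le hf _).trans ((l2_opNorm_le_iff (norm_nonneg A)).1 le_rfl _)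

end PrincipalSubmatrix

section TraceNorm

variable {ι : Type*} [Fintype ι] [DecidableEq ι] {A A' : Matrix ι ι ℝ} {δ δ' : ℝ}

/-- The trace norm of `A` is at most `δ`, expressed by duality with the operator norm. -/
def TraceNormLE (A : Matrix ι ι ℝ) (δ : ℝ) : Prop :=
  ∀ B : Matrix ι ι ℝ, |(A * B).trace| ≤ δ * ‖B‖

namespace TraceNormLE

theorem mono (h : TraceNormLE A δ) (hδ : δ ≤ δ') : TraceNormLE A δ' :=
  fun B => (h B).trans (by gcongr)

theorem add (h : TraceNormLE A δ) (h' : TraceNormLE A' δ') : TraceNormLE (A + A') (δ + δ') := by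
  intro B
  rw [add_mul, trace_add, add_mul]
  exact (abs_add_le _ _).trans (add_le_add (h B) (h' B))

theorem neg (h : TraceNormLE A δ) : TraceNormLE (-A) δ := by
  intro B
  rw [neg_mul, trace_neg, abs_neg]
  exact h B

theorem mul_mul (h : TraceNormLE A δ) (hδ : 0 ≤ δ) (X Y : Matrix ι ι ℝ) :
    TraceNormLE (X * A * Y) (‖X‖ * δ * ‖Y‖) := by
  intro B
  calc |(X * A * Y * B).trace| = |(A * (Y * B * X)).trace| := by
        rw [mul_assoc, mul_assoc, trace_mul_comm, mul_assoc]
    _ ≤ δ * ‖Y * B * X‖ := h _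
    _ ≤ δ * (‖Y‖ * ‖B‖ * ‖X‖) := by gcongr; exact norm_mul₃_le
    _ = ‖X‖ * δ * ‖Y‖ * ‖B‖ := by ring

theorem diagonal_diag (h : TraceNormLE A δ) (hδ : 0 ≤ δ) : TraceNormLE (diagonal A.diag) δ := by
  intro B
  calc |(diagonal A.diag * B).trace| = |(A * diagonal B.diag).trace| := by
        simp [trace, diagonal_mul, mul_diagonal]
    _ ≤ δ * ‖diagonal B.diag‖ := h _
    _ ≤ δ * ‖B‖ := by gcongr; exact l2_opNorm_diagonal_diag_le B

theorem abs_trace_le (h : TraceNormLE A δ) (hδ : 0 ≤ δ) : |A.trace| ≤ δ := by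
  have hone := h 1
  rw [mul_one] at hone
  exact hone.trans (mul_le_of_le_one_right hδ l2_opNorm_one_le)

theorem of_sum_abs (A : Matrix ι ι ℝ) : TraceNormLE A (∑ i, ∑ j, |A i j|) := by
  intro B
  simp only [trace, diag_apply, mul_apply, Finset.sum_mul]
  refine (Finset.abs_sum_le_sum_abs _ _).trans (Finset.sum_le_sum fun i _ => ?_)
  refine (Finset.abs_sum_le_sum_abs _ _).trans (Finset.sum_le_sum fun j _ => ?_)
  rw [abs_mul]
  gcongr
  exact abs_apply_le_l2_opNorm B j i

end TraceNormLE

end TraceNorm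

section Coercivity

variable {ι : Type*} [Fintype ι] {A A' : Matrix ι ι ℝ} {c C : ℝ}

/-- The quadratic form of `A`, which need not be symmetric, is bounded below by `c`. -/
def IsCoerciveWith (c : ℝ) (A : Matrix ι ι ℝ) : Prop :=
  ∀ x : ι → ℝ, c * (x ⬝ᵥ x) ≤ x ⬝ᵥ (A *ᵥ x)

namespace IsCoerciveWith

theorem submatrix {κ : Type*} [Fintype κ] {f : κ → ι} (h : IsCoerciveWith c A)
    (hf : f.Injective) : IsCoerciveWith c (A.submatrix f f) := by
  intro x
  rw [submatrix_mulVec_eq_mulVec_extend hf, dotProduct_comm x (_ ∘ f), ← dotProduct_extend_zero hf,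
    dotProduct_comm (A *ᵥ _), ← dotProduct_extend_zero_self hf x]
  exact h _

theorem sq_mul_dotProduct_self_le (hc : 0 ≤ c) (h : IsCoerciveWith c A) (x : ι → ℝ) :
    c ^ 2 * (x ⬝ᵥ x) ≤ (A *ᵥ x) ⬝ᵥ (A *ᵥ x) := by
  rcases (dotProduct_self_nonneg x).eq_or_lt with hx | hx
  · rw [← hx, mul_zero]
    exact dotProduct_self_nonneg _
  have cauchySchwarz : (x ⬝ᵥ (A *ᵥ x)) ^ 2 ≤ (x ⬝ᵥ x) * ((A *ᵥ x) ⬝ᵥ (A *ᵥ x)) := by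
    simpa only [dotProduct, sq] using Finset.sum_mul_sq_le_sq_mul_sq Finset.univ x (A *ᵥ x)
  refine le_of_mul_le_mul_left ?_ hx
  calc (x ⬝ᵥ x) * (c ^ 2 * (x ⬝ᵥ x)) = (c * (x ⬝ᵥ x)) ^ 2 := by ring
    _ ≤ (x ⬝ᵥ (A *ᵥ x)) ^ 2 := by gcongr; exact h x
    _ ≤ (x ⬝ᵥ x) * ((A *ᵥ x) ⬝ᵥ (A *ᵥ x)) := cauchySchwarz

theorem le_apply_self (h : IsCoerciveWith c A) (i : ι) : c ≤ A i i := by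
  classical
  simpa using h (Pi.single i 1)

variable [DecidableEq ι]

theorem diagonal_diag (h : IsCoerciveWith c A) : IsCoerciveWith c (diagonal A.diag) := by
  intro x
  simp only [dotProduct, mulVec_diagonal, diag_apply, Finset.mul_sum]
  refine Finset.sum_le_sum fun i _ => ?_
  nlinarith [h.le_apply_self i, mul_self_nonneg (x i)]

theorem isUnit_det (hc : 0 < c) (h : IsCoerciveWith c A) : IsUnit A.det := by
  rw [← isUnit_iff_isUnit_det, ← mulVec_injective_iff_isUnit]
  refine (injective_iff_map_eq_zero A.mulVecLin).2 fun x hx => ?_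
  have hle := h x
  rw [← mulVecLin_apply, hx, dotProduct_zero] at hle
  exact dotProduct_self_eq_zero.1
    (le_antisymm (nonpos_of_mul_nonpos_right hle hc) (dotProduct_self_nonneg x))

theorem mulVec_inv_mulVec (hc : 0 < c) (h : IsCoerciveWith c A) (x : ι → ℝ) :
    A *ᵥ (A⁻¹ *ᵥ x) = x := by
  rw [mulVec_mulVec, mul_nonsing_inv _ (h.isUnit_det hc), one_mulVec]

theorem l2_opNorm_inv_le (hc : 0 < c) (h : IsCoerciveWith c A) : ‖A⁻¹‖ ≤ c⁻¹ := by
  refine (l2_opNorm_le_iff (by positivity)).2 fun x => ?_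
  have hle := h.sq_mul_dotProduct_self_le hc.le (A⁻¹ *ᵥ x)
  rwa [h.mulVec_inv_mulVec hc, ← le_inv_mul_iff₀ (by positivity), ← inv_pow] at hle

theorem inv (hc : 0 < c) (hC : 0 < C) (hA : ‖A‖ ≤ C) (h : IsCoerciveWith c A) :
    IsCoerciveWith (c / C ^ 2) A⁻¹ := by
  intro x
  set y := A⁻¹ *ᵥ x
  have hAy : A *ᵥ y = x := h.mulVec_inv_mulVec hc x
  calc c / C ^ 2 * (x ⬝ᵥ x) ≤ c / C ^ 2 * (C ^ 2 * (y ⬝ᵥ y)) := by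
        gcongr
        simpa only [hAy] using (l2_opNorm_le_iff hC.le).1 hA y
    _ = c * (y ⬝ᵥ y) := by field_simp
    _ ≤ y ⬝ᵥ (A *ᵥ y) := h y
    _ = x ⬝ᵥ y := by rw [hAy, dotProduct_comm]

theorem inv_sub_inv (hc : 0 < c) (h : IsCoerciveWith c A) (h' : IsCoerciveWith c A') :
    A⁻¹ - A'⁻¹ = A⁻¹ * -(A - A') * A'⁻¹ := by
  rw [neg_sub, mul_sub, sub_mul, nonsing_inv_mul _ (h.isUnit_det hc), mul_assoc,
    mul_nonsing_inv _ (h'.isUnit_det hc), mul_one, one_mul]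

end IsCoerciveWith

end Coercivity

section TraceClose

variable {ι : Type*} [Fintype ι] [DecidableEq ι] {A A' D D' : Matrix ι ι ℝ} {B B' c δ : ℝ}

/-- `A` and `A'` are bounded by `B` in operator norm and differ by at most `B * δ` in trace norm.
With a single constant for both bounds, the relation is stable under matrix products. -/
structure TraceClose (B δ : ℝ) (A A' : Matrix ι ι ℝ) : Prop where
  norm_left : ‖A‖ ≤ B
  norm_right : ‖A'‖ ≤ B
  traceNormLE_sub : TraceNormLE (A - A') (B * δ)

namespace TraceClose

theorem nonneg (h : TraceClose B δ A A') : 0 ≤ B := (norm_nonneg A).trans h.norm_left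

theorem one (hδ : 0 ≤ δ) : TraceClose 1 δ (1 : Matrix ι ι ℝ) 1 where
  norm_left := l2_opNorm_one_le
  norm_right := l2_opNorm_one_le
  traceNormLE_sub X := by
    rw [sub_self, zero_mul, trace_zero, abs_zero]
    positivity

theorem mul (hδ : 0 ≤ δ) (h : TraceClose B δ A A') (h' : TraceClose B' δ D D') :
    TraceClose (2 * (B * B')) δ (A * D) (A' * D') := by
  have hB := h.nonneg
  have hB' := h'.nonneg
  have hBB' : B * B' ≤ 2 * (B * B') := by linarith [mul_nonneg hB hB']
  refine ⟨(norm_mul_le_of_le h.norm_left h'.norm_left).trans hBB',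
    (norm_mul_le_of_le h.norm_right h'.norm_right).trans hBB', ?_⟩
  have telescope : A * D - A' * D' = 1 * (A - A') * D + A' * (D - D') * 1 := by noncomm_ring
  rw [telescope]
  refine ((h.traceNormLE_sub.mul_mul (by positivity) 1 D).add
    (h'.traceNormLE_sub.mul_mul (by positivity) A' 1)).mono ?_
  calc ‖(1 : Matrix ι ι ℝ)‖ * (B * δ) * ‖D‖ + ‖A'‖ * (B' * δ) * ‖(1 : Matrix ι ι ℝ)‖
      ≤ 1 * (B * δ) * B' + B * (B' * δ) * 1 := by
        gcongr
        exacts [l2_opNorm_one_le, h'.norm_left, h.norm_right, l2_opNorm_one_le]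
    _ = 2 * (B * B') * δ := by ring

theorem diagonal_diag (hδ : 0 ≤ δ) (h : TraceClose B δ A A') :
    TraceClose B δ (diagonal A.diag) (diagonal A'.diag) where
  norm_left := (l2_opNorm_diagonal_diag_le A).trans h.norm_left
  norm_right := (l2_opNorm_diagonal_diag_le A').trans h.norm_right
  traceNormLE_sub := by
    rw [diagonal_sub]
    exact h.traceNormLE_sub.diagonal_diag (mul_nonneg h.nonneg hδ)

theorem inv (hδ : 0 ≤ δ) (hc : 0 < c) (hA : IsCoerciveWith c A) (hA' : IsCoerciveWith c A')
    (h : TraceClose B δ A A') : TraceClose (c⁻¹ + c⁻¹ * B * c⁻¹) δ A⁻¹ A'⁻¹ := by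
  have hB := h.nonneg
  have hle : c⁻¹ ≤ c⁻¹ + c⁻¹ * B * c⁻¹ := le_add_of_nonneg_right (by positivity)
  refine ⟨(hA.l2_opNorm_inv_le hc).trans hle, (hA'.l2_opNorm_inv_le hc).trans hle, ?_⟩
  rw [hA.inv_sub_inv hc hA']
  refine (h.traceNormLE_sub.neg.mul_mul (by positivity) _ _).mono ?_
  calc ‖A⁻¹‖ * (B * δ) * ‖A'⁻¹‖ ≤ c⁻¹ * (B * δ) * c⁻¹ := by
        gcongr
        exacts [hA.l2_opNorm_inv_le hc, hA'.l2_opNorm_inv_le hc]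
    _ = c⁻¹ * B * c⁻¹ * δ := by ring
    _ ≤ (c⁻¹ + c⁻¹ * B * c⁻¹) * δ := by
        gcongr
        exact le_add_of_nonneg_left (by positivity)

theorem list_prod (hδ : 0 ≤ δ) {α : Type*} {F F' : α → Matrix ι ι ℝ} {B : α → ℝ}
    (h : ∀ s, TraceClose (B s) δ (F s) (F' s)) (l : List α) :
    TraceClose (l.map fun s => 2 * B s).prod δ (l.map F).prod (l.map F').prod := by
  induction l with
  | nil => exact one hδ
  | cons s l ih =>
    simp only [List.map_cons, List.prod_cons, mul_assoc]
    exact (h s).mul hδ ih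

end TraceClose

end TraceClose

section Words

variable {p : ℕ} {ι : Type*} [Fintype ι] [DecidableEq ι]

/-- The matrix `R_θ^I` of the paper, computed from an arbitrary family `R` of matrices in which
`R []` stands for `R_θ` and `R I` for its derivatives. -/
def ndEval (R : List (Fin p) → Matrix ι ι ℝ) : NdIndex p → Matrix ι ι ℝ
  | .deriv I _ => R I
  | .inv => (R [])⁻¹

/-- The factor `M_d^I` of the paper, computed from an arbitrary family `R` of matrices. -/
def factorEval (R : List (Fin p) → Matrix ι ι ℝ) : FactorLabel p → Matrix ι ι ℝ
  | .nd I => ndEval R I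
  | .sd => (diagonal ((R [])⁻¹).diag)⁻¹
  | .bd L => diagonal ((L.map (ndEval R)).prod).diag

/-- The product of the factors with labels `w`, computed from an arbitrary family `R` of
matrices. -/
def wordEval (R : List (Fin p) → Matrix ι ι ℝ) (w : List (FactorLabel p)) : Matrix ι ι ℝ :=
  (w.map (factorEval R)).prod

/-- The matrices `R I` with `I` of length at most three are bounded by `C` in operator norm, and
`R []` is coercive with constant `c`. -/
structure RegularFamily (c C : ℝ) (R : List (Fin p) → Matrix ι ι ℝ) : Prop where
  norm_le : ∀ I : List (Fin p), I.length ≤ 3 → ‖R I‖ ≤ C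
  coercive : IsCoerciveWith c (R [])

variable {c C : ℝ}

namespace RegularFamily

variable {R : List (Fin p) → Matrix ι ι ℝ}

theorem submatrix {κ : Type*} [Fintype κ] [DecidableEq κ] {f : κ → ι} (hR : RegularFamily c C R)
    (hf : f.Injective) : RegularFamily c C fun I => (R I).submatrix f f where
  norm_le I hI := (l2_opNorm_submatrix_le hf (R I)).trans (hR.norm_le I hI)
  coercive := hR.coercive.submatrix hf

theorem coercive_diagonal_diag_inv (hc : 0 < c) (hC : 0 < C) (hR : RegularFamily c C R) :
    IsCoerciveWith (c / C ^ 2) (diagonal ((R [])⁻¹).diag) :=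
  (hR.coercive.inv hc hC (hR.norm_le [] (Nat.zero_le 3))).diagonal_diag

end RegularFamily

theorem exists_traceClose_ndEval (hc : 0 < c) (C : ℝ) (I : NdIndex p) :
    ∃ B : ℝ, ∀ {ι : Type u} [Fintype ι] [DecidableEq ι] {R R' : List (Fin p) → Matrix ι ι ℝ},
      RegularFamily c C R → RegularFamily c C R' → ∀ {δ : ℝ}, 0 ≤ δ →
      (∀ I : List (Fin p), I.length ≤ 3 → TraceNormLE (R I - R' I) δ) →
      TraceClose B δ (ndEval R I) (ndEval R' I) := by
  have deriv : ∀ I : List (Fin p), I.length ≤ 3 → ∀ {ι : Type u} [Fintype ι] [DecidableEq ι]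
      {R R' : List (Fin p) → Matrix ι ι ℝ}, RegularFamily c C R → RegularFamily c C R' →
      ∀ {δ : ℝ}, 0 ≤ δ → TraceNormLE (R I - R' I) δ → TraceClose (max C 1) δ (R I) (R' I) :=
    fun I hI _ _ _ _ _ hR hR' _ hδ h =>
      ⟨(hR.norm_le I hI).trans (le_max_left _ _), (hR'.norm_le I hI).trans (le_max_left _ _),
        h.mono (le_mul_of_one_le_left hδ (le_max_right _ _))⟩
  cases I with
  | deriv I hI => exact ⟨_, fun hR hR' _ hδ h => deriv I hI hR hR' hδ (h I hI)⟩
  | inv =>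
    exact ⟨_, fun hR hR' _ hδ h => (deriv [] (Nat.zero_le 3) hR hR' hδ (h [] (Nat.zero_le 3))).inv
      hδ hc hR.coercive hR'.coercive⟩

theorem exists_traceClose_factorEval (hc : 0 < c) (hC : 0 < C) (s : FactorLabel p) :
    ∃ B : ℝ, ∀ {ι : Type u} [Fintype ι] [DecidableEq ι] {R R' : List (Fin p) → Matrix ι ι ℝ},
      RegularFamily c C R → RegularFamily c C R' → ∀ {δ : ℝ}, 0 ≤ δ →
      (∀ I : List (Fin p), I.length ≤ 3 → TraceNormLE (R I - R' I) δ) →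
      TraceClose B δ (factorEval R s) (factorEval R' s) := by
  choose B hB using exists_traceClose_ndEval.{u} (p := p) hc C
  cases s with
  | nd I => exact ⟨B I, hB I⟩
  | sd =>
    exact ⟨_, fun hR hR' _ hδ h => ((hB .inv hR hR' hδ h).diagonal_diag hδ).inv hδ
      (div_pos hc (pow_pos hC 2)) (hR.coercive_diagonal_diag_inv hc hC)
      (hR'.coercive_diagonal_diag_inv hc hC)⟩
  | bd L =>
    exact ⟨_, fun hR hR' _ hδ h =>
      (TraceClose.list_prod hδ (fun I => hB I hR hR' hδ h) L).diagonal_diag hδ⟩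

theorem exists_traceClose_wordEval (hc : 0 < c) (hC : 0 < C) (w : List (FactorLabel p)) :
    ∃ B : ℝ, ∀ {ι : Type u} [Fintype ι] [DecidableEq ι] {R R' : List (Fin p) → Matrix ι ι ℝ},
      RegularFamily c C R → RegularFamily c C R' → ∀ {δ : ℝ}, 0 ≤ δ →
      (∀ I : List (Fin p), I.length ≤ 3 → TraceNormLE (R I - R' I) δ) →
      TraceClose B δ (wordEval R w) (wordEval R' w) := by
  choose B hB using exists_traceClose_factorEval.{u} (p := p) hc hC
  exact ⟨_, fun hR hR' _ hδ h => TraceClose.list_prod hδ (fun s => hB s hR hR' hδ h) w⟩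

end Words

section Reindex

theorem diagonal_diag_submatrix {ι κ : Type*} [DecidableEq ι] [DecidableEq κ]
    (A : Matrix ι ι ℝ) (e : κ ≃ ι) :
    diagonal (A.submatrix e e).diag = (diagonal A.diag).submatrix e e :=
  (submatrix_diagonal_equiv A.diag e).symm

theorem trace_submatrix_equiv {ι κ : Type*} [Fintype ι] [Fintype κ]
    (A : Matrix ι ι ℝ) (e : κ ≃ ι) :
    (A.submatrix e e).trace = A.trace :=
  e.sum_comp fun i => A i i

variable {p : ℕ} {ι κ : Type*} [Fintype ι] [DecidableEq ι] [Fintype κ] [DecidableEq κ]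

theorem list_prod_submatrix {α : Type*} (l : List α) (F : α → Matrix ι ι ℝ) (e : κ ≃ ι) :
    (l.map fun s => (F s).submatrix e e).prod = ((l.map F).prod).submatrix e e := by
  simpa [Function.comp_def] using (map_list_prod (reindexRingEquiv ℝ e.symm) (l.map F)).symm

theorem ndEval_submatrix (R : List (Fin p) → Matrix ι ι ℝ) (e : κ ≃ ι) (I : NdIndex p) :
    ndEval (fun I => (R I).submatrix e e) I = (ndEval R I).submatrix e e := by
  cases I with
  | deriv I hI => rfl
  | inv => exact inv_submatrix_equiv (R []) e e

theorem factorEval_submatrix (R : List (Fin p) → Matrix ι ι ℝ) (e : κ ≃ ι) (s : FactorLabel p) :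
    factorEval (fun I => (R I).submatrix e e) s = (factorEval R s).submatrix e e := by
  cases s with
  | nd I => exact ndEval_submatrix R e I
  | sd => simp only [factorEval, inv_submatrix_equiv, diagonal_diag_submatrix]
  | bd L =>
    simp only [factorEval, ← diagonal_diag_submatrix, ← list_prod_submatrix,
      funext (ndEval_submatrix R e)]

theorem wordEval_submatrix (R : List (Fin p) → Matrix ι ι ℝ) (e : κ ≃ ι)
    (w : List (FactorLabel p)) :
    wordEval (fun I => (R I).submatrix e e) w = (wordEval R w).submatrix e e := by
  simp only [wordEval, ← list_prod_submatrix, funext (factorEval_submatrix R e)]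

end Reindex

section BlockDiagonal

theorem diagonal_diag_blockDiagonal' {β : Type*} [DecidableEq β] {ι : β → Type*}
    [∀ b, DecidableEq (ι b)] (M : ∀ b, Matrix (ι b) (ι b) ℝ) :
    diagonal (blockDiagonal' M).diag = blockDiagonal' fun b => diagonal (M b).diag := by
  rw [blockDiagonal'_diagonal]
  exact congrArg diagonal (funext fun i => blockDiagonal'_apply_eq M i.1 i.2 i.2)

variable {p : ℕ} {β : Type*} [Fintype β] [DecidableEq β] {ι : β → Type*} [∀ b, Fintype (ι b)]

theorem blockDiagonal'_mulVec (M : ∀ b, Matrix (ι b) (ι b) ℝ) (x : (Σ b, ι b) → ℝ) (b : β)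
    (i : ι b) : (blockDiagonal' M *ᵥ x) ⟨b, i⟩ = (M b *ᵥ fun j => x ⟨b, j⟩) i := by
  simp only [mulVec, dotProduct]
  rw [Fintype.sum_sigma, Fintype.sum_eq_single b fun b' hb' => ?_]
  · simp only [blockDiagonal'_apply_eq]
  · exact Finset.sum_eq_zero fun j _ => by rw [blockDiagonal'_apply_ne _ _ _ hb'.symm, zero_mul]

theorem IsCoerciveWith.blockDiagonal' {M : ∀ b, Matrix (ι b) (ι b) ℝ} {c : ℝ}
    (h : ∀ b, IsCoerciveWith c (M b)) : IsCoerciveWith c (blockDiagonal' M) := by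
  intro x
  simp only [dotProduct, Fintype.sum_sigma, blockDiagonal'_mulVec]
  rw [Finset.mul_sum]
  exact Finset.sum_le_sum fun b _ => h b fun j => x ⟨b, j⟩

variable [∀ b, DecidableEq (ι b)]

theorem list_prod_blockDiagonal' {α : Type*} (l : List α) (F : α → ∀ b, Matrix (ι b) (ι b) ℝ) :
    (l.map fun s => blockDiagonal' (F s)).prod
      = blockDiagonal' fun b => (l.map fun s => F s b).prod := by
  have h := map_list_prod (blockDiagonal'RingHom ι ℝ) (l.map F)
  rw [List.map_map] at h
  refine h.symm.trans (congrArg blockDiagonal' (funext fun b => ?_))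
  rw [Pi.list_prod_apply, List.map_map]
  rfl

theorem inv_blockDiagonal' (M : ∀ b, Matrix (ι b) (ι b) ℝ) (h : ∀ b, IsUnit (M b).det) :
    (blockDiagonal' M)⁻¹ = blockDiagonal' fun b => (M b)⁻¹ := by
  refine inv_eq_right_inv ?_
  rw [← blockDiagonal'_mul, ← blockDiagonal'_one]
  exact congrArg _ (funext fun b => mul_nonsing_inv _ (h b))

theorem l2_opNorm_blockDiagonal'_le {M : ∀ b, Matrix (ι b) (ι b) ℝ} {C : ℝ} (hC : 0 ≤ C)
    (h : ∀ b, ‖M b‖ ≤ C) : ‖blockDiagonal' M‖ ≤ C := by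
  refine (l2_opNorm_le_iff hC).2 fun x => ?_
  simp only [dotProduct, Fintype.sum_sigma, blockDiagonal'_mulVec]
  rw [Finset.mul_sum]
  exact Finset.sum_le_sum fun b _ => (l2_opNorm_le_iff hC).1 (h b) fun j => x ⟨b, j⟩

variable {c C : ℝ} {R : ∀ b, List (Fin p) → Matrix (ι b) (ι b) ℝ}

theorem RegularFamily.blockDiagonal' (hC : 0 ≤ C) (h : ∀ b, RegularFamily c C (R b)) :
    RegularFamily c C fun I => blockDiagonal' fun b => R b I where
  norm_le I hI := l2_opNorm_blockDiagonal'_le hC fun b => (h b).norm_le I hI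
  coercive := IsCoerciveWith.blockDiagonal' fun b => (h b).coercive

theorem ndEval_blockDiagonal' (hc : 0 < c) (h : ∀ b, RegularFamily c C (R b)) (I : NdIndex p) :
    ndEval (fun I => blockDiagonal' fun b => R b I) I
      = blockDiagonal' fun b => ndEval (R b) I := by
  cases I with
  | deriv I hI => rfl
  | inv => exact inv_blockDiagonal' _ fun b => (h b).coercive.isUnit_det hc

theorem factorEval_blockDiagonal' (hc : 0 < c) (hC : 0 < C) (h : ∀ b, RegularFamily c C (R b))
    (s : FactorLabel p) :
    factorEval (fun I => blockDiagonal' fun b => R b I) s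
      = blockDiagonal' fun b => factorEval (R b) s := by
  cases s with
  | nd I => exact ndEval_blockDiagonal' hc h I
  | sd =>
    simp only [factorEval]
    rw [inv_blockDiagonal' _ fun b => (h b).coercive.isUnit_det hc, diagonal_diag_blockDiagonal',
      inv_blockDiagonal' _ fun b =>
        ((h b).coercive_diagonal_diag_inv hc hC).isUnit_det (div_pos hc (pow_pos hC 2))]
  | bd L =>
    simp only [factorEval, ← diagonal_diag_blockDiagonal', ← list_prod_blockDiagonal',
      funext (ndEval_blockDiagonal' hc h)]

theorem wordEval_blockDiagonal' (hc : 0 < c) (hC : 0 < C) (h : ∀ b, RegularFamily c C (R b))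
    (w : List (FactorLabel p)) :
    wordEval (fun I => blockDiagonal' fun b => R b I) w
      = blockDiagonal' fun b => wordEval (R b) w := by
  simp only [wordEval, ← list_prod_blockDiagonal', funext (factorEval_blockDiagonal' hc hC h)]

end BlockDiagonal

section Decoupling

variable {p : ℕ} {c C : ℝ} {ι : Type u} {β : Type v} [DecidableEq β]

/-- The matrix obtained from `A` by setting to zero the entries outside the diagonal blocks defined
by the labelling `π` of its indices. -/
def blockPart (π : ι → β) (A : Matrix ι ι ℝ) : Matrix ι ι ℝ :=
  of fun i j => if π i = π j then A i j else 0

/-- The diagonal block of `A` with label `b`. -/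
def blockAt (π : ι → β) (A : Matrix ι ι ℝ) (b : β) :
    Matrix {i // π i = b} {i // π i = b} ℝ :=
  A.submatrix Subtype.val Subtype.val

theorem blockPart_eq_submatrix_blockDiagonal' (π : ι → β) (A : Matrix ι ι ℝ) :
    blockPart π A = (blockDiagonal' (blockAt π A)).submatrix
      (Equiv.sigmaFiberEquiv π).symm (Equiv.sigmaFiberEquiv π).symm := by
  ext i j
  simp only [blockPart, of_apply, submatrix_apply, Equiv.sigmaFiberEquiv, Equiv.coe_fn_symm_mk]
  split_ifs with hij
  · have sameFibre : (⟨π j, ⟨j, rfl⟩⟩ : Σ b, {i // π i = b}) = ⟨π i, ⟨j, hij.symm⟩⟩ :=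
      Sigma.subtype_ext hij.symm rfl
    rw [sameFibre, blockDiagonal'_apply_eq]
    rfl
  · rw [blockDiagonal'_apply_ne _ _ _ hij]

variable [Fintype ι] [DecidableEq ι]

theorem RegularFamily.blockPart [Finite β] {R : List (Fin p) → Matrix ι ι ℝ} (hC : 0 ≤ C)
    (hR : RegularFamily c C R) (π : ι → β) : RegularFamily c C fun I => blockPart π (R I) := by
  cases nonempty_fintype β
  simp only [blockPart_eq_submatrix_blockDiagonal']
  exact (RegularFamily.blockDiagonal' hC fun _ => hR.submatrix Subtype.val_injective).submatrix
    (Equiv.injective _)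

theorem trace_wordEval_blockPart [Fintype β] {R : List (Fin p) → Matrix ι ι ℝ} (hc : 0 < c)
    (hC : 0 < C) (hR : RegularFamily c C R) (π : ι → β) (w : List (FactorLabel p)) :
    (wordEval (fun I => blockPart π (R I)) w).trace
      = ∑ b, (wordEval (fun I => blockAt π (R I) b) w).trace := by
  simp only [blockPart_eq_submatrix_blockDiagonal', wordEval_submatrix, trace_submatrix_equiv]
  rw [wordEval_blockDiagonal' (R := fun b I => blockAt π (R I) b) hc hC
    (fun _ => hR.submatrix Subtype.val_injective), trace_blockDiagonal']

theorem exists_abs_trace_wordEval_sub_sum_blockAt_le (hc : 0 < c) (hC : 0 < C)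
    (w : List (FactorLabel p)) : ∃ B : ℝ, ∀ {ι : Type u} {β : Type v} [Fintype ι]
      [DecidableEq ι] [Fintype β] [DecidableEq β] (π : ι → β) {R : List (Fin p) → Matrix ι ι ℝ},
      RegularFamily c C R → ∀ {δ : ℝ}, 0 ≤ δ →
      (∀ I : List (Fin p), I.length ≤ 3 →
        ∑ i, ∑ j, (if π i = π j then 0 else |R I i j|) ≤ δ) →
      |(wordEval R w).trace - ∑ b, (wordEval (fun I => blockAt π (R I) b) w).trace|
        ≤ B * δ := by
  obtain ⟨B, hB⟩ := exists_traceClose_wordEval.{u} hc hC w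
  refine ⟨B, fun π R hR δ hδ hoff => ?_⟩
  have hclose := hB hR (hR.blockPart hC.le π) hδ fun I hI =>
    (TraceNormLE.of_sum_abs _).mono <| le_of_eq_of_le (Finset.sum_congr rfl fun i _ =>
      Finset.sum_congr rfl fun j _ => by
        rw [Matrix.sub_apply, blockPart, of_apply]
        split_ifs <;> simp only [sub_self, sub_zero, abs_zero]) (hoff I hI)
  rw [← trace_wordEval_blockPart hc hC hR, ← trace_sub]
  exact hclose.traceNormLE_sub.abs_trace_le (mul_nonneg hclose.nonneg hδ)

end Decoupling

section Measurability

/-- All entries of the random matrix `A` are measurable. -/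
def EntryMeasurable {α ι : Type*} [MeasurableSpace α] (A : α → Matrix ι ι ℝ) : Prop :=
  ∀ i j, Measurable fun ω => A ω i j

theorem EntryMeasurable.diagonal_diag {α ι : Type*} [MeasurableSpace α] [DecidableEq ι]
    {A : α → Matrix ι ι ℝ} (hA : EntryMeasurable A) :
    EntryMeasurable fun ω => diagonal (A ω).diag := fun i j => by
  rcases eq_or_ne i j with rfl | h
  · simpa only [diagonal_apply_eq, diag_apply] using hA i i
  · simp only [diagonal_apply_ne _ h, measurable_const]

variable {p : ℕ} {α : Type*} [MeasurableSpace α] {ι : Type*} [Fintype ι]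

theorem EntryMeasurable.mul {A B : α → Matrix ι ι ℝ} (hA : EntryMeasurable A)
    (hB : EntryMeasurable B) : EntryMeasurable fun ω => A ω * B ω := fun i j => by
  simp only [Matrix.mul_apply]
  exact Finset.measurable_sum _ fun k _ => (hA i k).mul (hB k j)

variable [DecidableEq ι]

theorem EntryMeasurable.det {A : α → Matrix ι ι ℝ} (hA : EntryMeasurable A) :
    Measurable fun ω => (A ω).det := by
  simp only [Matrix.det_apply]
  exact Finset.measurable_sum _ fun σ _ =>
    (Finset.measurable_prod _ fun i _ => hA _ _).const_smul _

theorem EntryMeasurable.inv {A : α → Matrix ι ι ℝ} (hA : EntryMeasurable A) :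
    EntryMeasurable fun ω => (A ω)⁻¹ := fun i j => by
  simp only [Matrix.inv_def, Matrix.smul_apply, Ring.inverse_eq_inv', smul_eq_mul,
    Matrix.adjugate_apply]
  refine hA.det.inv.mul (EntryMeasurable.det fun k l => ?_)
  rcases eq_or_ne k j with rfl | hk
  · simp only [updateRow_self, measurable_const]
  · simpa only [updateRow_ne hk] using hA k l

theorem EntryMeasurable.list_prod {β : Type*} (l : List β) (F : β → α → Matrix ι ι ℝ)
    (h : ∀ s, EntryMeasurable (F s)) : EntryMeasurable fun ω => (l.map fun s => F s ω).prod := by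
  induction l with
  | nil => exact fun i j => measurable_const
  | cons s l ih => simpa only [List.map_cons, List.prod_cons] using (h s).mul ih

variable {R : α → List (Fin p) → Matrix ι ι ℝ}

theorem EntryMeasurable.ndEval
    (h : ∀ I : List (Fin p), I.length ≤ 3 → EntryMeasurable fun ω => R ω I) (I : NdIndex p) :
    EntryMeasurable fun ω => ndEval (R ω) I := by
  cases I with
  | deriv I hI => exact h I hI
  | inv => exact (h [] (Nat.zero_le 3)).inv

theorem EntryMeasurable.factorEval
    (h : ∀ I : List (Fin p), I.length ≤ 3 → EntryMeasurable fun ω => R ω I) (s : FactorLabel p) :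
    EntryMeasurable fun ω => factorEval (R ω) s := by
  cases s with
  | nd I => exact EntryMeasurable.ndEval h I
  | sd => exact (h [] (Nat.zero_le 3)).inv.diagonal_diag.inv
  | bd L => exact (EntryMeasurable.list_prod L _ fun I => EntryMeasurable.ndEval h I).diagonal_diag

theorem measurable_trace_wordEval
    (h : ∀ I : List (Fin p), I.length ≤ 3 → EntryMeasurable fun ω => R ω I)
    (w : List (FactorLabel p)) : Measurable fun ω => (wordEval (R ω) w).trace :=
  Finset.measurable_sum _ fun i _ =>
    EntryMeasurable.list_prod w _ (fun s => EntryMeasurable.factorEval h s) i i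

end Measurability

section Lattice

variable {d : ℕ} {s : ℝ}

theorem norm_intCast_pi (w : Fin d → ℤ) : ‖fun k => (w k : ℝ)‖ = ‖w‖ := by
  simp only [Pi.norm_def, nnnorm, Int.norm_cast_real]

theorem exists_norm_apply_eq_norm {w : Fin d → ℤ} (hw : w ≠ 0) : ∃ k, ‖w k‖ = ‖w‖ := by
  by_contra! hne
  exact lt_irrefl _ ((pi_norm_lt_iff (norm_pos_iff.2 hw)).2 fun k =>
    lt_of_le_of_ne (norm_le_pi_norm _ k) (hne k))

theorem one_le_norm_of_ne_zero {w : Fin d → ℤ} (hw : w ≠ 0) : 1 ≤ ‖w‖ := by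
  obtain ⟨k, hk⟩ := exists_norm_apply_eq_norm hw
  have hwk : w k ≠ 0 := norm_ne_zero_iff.1 (hk ▸ norm_ne_zero_iff.2 hw)
  rw [← hk, Int.norm_eq_abs]
  exact_mod_cast Int.one_le_abs hwk

theorem summable_norm_pow_inv_int {k : ℕ} (hk : d < k) :
    Summable fun w : Fin d → ℤ => (‖w‖ ^ k)⁻¹ := by
  let b := Pi.basisFun ℝ (Fin d)
  let L : Submodule ℤ (Fin d → ℝ) := Submodule.span ℤ (Set.range b)
  have hrank : Module.finrank ℤ L = d := by rw [ZLattice.rank ℝ L, Module.finrank_fin_fun]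
  have hmem : ∀ w : Fin d → ℤ, (fun k => (w k : ℝ)) ∈ L := fun w =>
    (b.mem_span_iff_repr_mem ℤ _).2 fun k => ⟨w k, by simp [b]⟩
  have hinj : Function.Injective fun w => (⟨_, hmem w⟩ : L) := fun w w' h => by
    ext k
    exact Int.cast_injective (congrFun (congrArg Subtype.val h) k)
  refine ((ZLattice.summable_norm_pow_inv (L := L) k (hrank.trans_lt hk)).comp_injective
    hinj).congr fun w => ?_
  rw [Function.comp_apply, Submodule.coe_norm, norm_intCast_pi, inv_pow]

/-- The summable weight on `ℤ^d` that dominates the covariances of two observation points whose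
grid positions differ by `w`, when distances between observation points are at least `s` times the
distances between their grid positions. -/
def decayProfile (d : ℕ) (s : ℝ) (w : Fin d → ℤ) : ℝ := 1 / (1 + (s * ‖w‖) ^ (d + 1))

theorem decayProfile_pos (hs : 0 < s) (w : Fin d → ℤ) : 0 < decayProfile d s w := by
  unfold decayProfile; positivity

theorem decayProfile_neg (w : Fin d → ℤ) : decayProfile d s (-w) = decayProfile d s w := by
  unfold decayProfile; rw [norm_neg]

theorem summable_decayProfile (hs : 0 < s) : Summable (decayProfile d s) := by
  have hsum := (summable_norm_pow_inv_int (Nat.lt_succ_self d)).mul_left (s ^ (d + 1))⁻¹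
  refine Summable.of_norm_bounded_eventually hsum ?_
  filter_upwards [(Set.finite_singleton (0 : Fin d → ℤ)).compl_mem_cofinite] with w hw
  have : 0 < ‖w‖ := norm_pos_iff.2 hw
  rw [Real.norm_of_nonneg (decayProfile_pos hs w).le, decayProfile, ← mul_inv, ← mul_pow,
    ← one_div]
  exact one_div_le_one_div_of_le (by positivity) (by linarith)

theorem tsum_decayProfile_pos (hs : 0 < s) : 0 < ∑' w, decayProfile d s w :=
  (summable_decayProfile hs).tsum_pos (fun w => (decayProfile_pos hs w).le) 0
    (decayProfile_pos hs 0)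

theorem sum_decayProfile_sub_left_le (hs : 0 < s) {ι : Type*} [Fintype ι] {u : ι → Fin d → ℤ}
    (hu : Function.Injective u) (z : Fin d → ℤ) :
    ∑ j, decayProfile d s (z - u j) ≤ ∑' w, decayProfile d s w := by
  have hinj : Function.Injective fun j => z - u j := sub_right_injective.comp hu
  rw [← tsum_fintype (L := .unconditional _)]
  exact ((summable_decayProfile hs).comp_injective hinj).tsum_le_tsum_of_inj _ hinj
    (fun _ _ => (decayProfile_pos hs _).le) (fun _ => le_rfl) (summable_decayProfile hs)

theorem sum_decayProfile_sub_right_le (hs : 0 < s) {ι : Type*} [Fintype ι] {u : ι → Fin d → ℤ}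
    (hu : Function.Injective u) (z : Fin d → ℤ) :
    ∑ j, decayProfile d s (u j - z) ≤ ∑' w, decayProfile d s w := by
  simpa only [← decayProfile_neg (_ - z), neg_sub] using sum_decayProfile_sub_left_le hs hu z

theorem inv_norm_pow_le_mul_decayProfile {E : Type*} [SeminormedAddCommGroup E] (hs : 0 < s)
    {w : Fin d → ℤ} (hw : w ≠ 0) {t : E} (ht : s * ‖w‖ ≤ ‖t‖) :
    (‖t‖ ^ (d + 1))⁻¹ ≤ (1 + (s ^ (d + 1))⁻¹) * decayProfile d s w := by
  have hP : s ^ (d + 1) ≤ (s * ‖w‖) ^ (d + 1) := by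
    gcongr
    exact le_mul_of_one_le_right hs.le (one_le_norm_of_ne_zero hw)
  rw [decayProfile]
  calc (‖t‖ ^ (d + 1))⁻¹ ≤ ((s * ‖w‖) ^ (d + 1))⁻¹ := by gcongr
    _ = (1 + ((s * ‖w‖) ^ (d + 1))⁻¹) * (1 / (1 + (s * ‖w‖) ^ (d + 1))) := by
        have : 0 < (s * ‖w‖) ^ (d + 1) := (pow_pos hs _).trans_le hP
        field_simp
        rw [add_comm]
    _ ≤ (1 + (s ^ (d + 1))⁻¹) * (1 / (1 + (s * ‖w‖) ^ (d + 1))) := by gcongr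

end Lattice

section Grid

variable {d : ℕ} {ι : Type*}

/-- The point `u_i + ε x_i` for a grid position `u_i`. Unlike `obsPoint`, it allows positions in
`ℤ^d`, hence translations, and an arbitrary index type, hence subfamilies. -/
def gridPoint (ε : ℝ) (u : ι → Fin d → ℤ) (x : ι → EuclideanSpace ℝ (Fin d)) (i : ι) :
    EuclideanSpace ℝ (Fin d) :=
  WithLp.toLp 2 (fun k => (u i k : ℝ)) + ε • x i

theorem le_norm_gridPoint_sub {ε : ℝ} (hε : 0 ≤ ε) (u : ι → Fin d → ℤ)
    {x : ι → EuclideanSpace ℝ (Fin d)} (hx : ∀ i k, |x i k| ≤ 1) (i j : ι) :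
    (1 - 2 * ε) * ‖u i - u j‖ ≤ ‖gridPoint ε u x i - gridPoint ε u x j‖ := by
  rcases eq_or_ne (u i - u j) 0 with h | h
  · simp only [h, norm_zero, mul_zero, norm_nonneg]
  obtain ⟨k, hk⟩ := exists_norm_apply_eq_norm h
  have hone : 1 ≤ |((u i - u j) k : ℝ)| := by
    simpa only [← Int.norm_eq_abs, hk] using one_le_norm_of_ne_zero h
  have hx2 : |x i k - x j k| ≤ 2 := (abs_sub _ _).trans (by linarith [hx i k, hx j k])
  have htri : |((u i - u j) k : ℝ)| - ε * |x i k - x j k|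
      ≤ ‖(gridPoint ε u x i - gridPoint ε u x j) k‖ := by
    nth_rw 1 [← abs_of_nonneg hε]
    rw [← abs_mul, ← abs_neg (ε * _)]
    refine (abs_sub_abs_le_abs_sub _ _).trans_eq ?_
    rw [Real.norm_eq_abs, gridPoint, gridPoint]
    congr 1
    simp only [Pi.sub_apply, PiLp.sub_apply, PiLp.add_apply, PiLp.smul_apply, smul_eq_mul]
    push_cast
    ring
  calc (1 - 2 * ε) * ‖u i - u j‖ = (1 - 2 * ε) * |((u i - u j) k : ℝ)| := by
        rw [← hk, Int.norm_eq_abs]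
    _ ≤ |((u i - u j) k : ℝ)| - ε * |x i k - x j k| := by nlinarith
    _ ≤ _ := htri.trans (PiLp.norm_apply_le _ k)

end Grid

section CosTransform

variable {d : ℕ} {q h : EuclideanSpace ℝ (Fin d) → ℝ}

/-- The cosine transform `t ↦ ∫ h(f) cos (f·t) df`; Fourier inversion exhibits `K_θ` as the cosine
transform of its spectral density. -/
def cosTransform (h : EuclideanSpace ℝ (Fin d) → ℝ) (t : EuclideanSpace ℝ (Fin d)) : ℝ :=
  ∫ f, h f * Real.cos (inner ℝ f t)

theorem integrable_mul_cos (hh : Integrable h) (t : EuclideanSpace ℝ (Fin d)) :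
    Integrable fun f => h f * Real.cos (inner ℝ f t) :=
  hh.mul_bdd (c := 1) (Continuous.aestronglyMeasurable (by fun_prop))
    (Eventually.of_forall fun _ => Real.abs_cos_le_one _)

theorem cosTransform_sub (hh : Integrable h) (hq : Integrable q) (t : EuclideanSpace ℝ (Fin d)) :
    cosTransform (fun f => h f - q f) t = cosTransform h t - cosTransform q t := by
  simp only [cosTransform, sub_mul]
  exact integral_sub (integrable_mul_cos hh t) (integrable_mul_cos hq t)

theorem cosTransform_const_mul (δ : ℝ) (q : EuclideanSpace ℝ (Fin d) → ℝ)
    (t : EuclideanSpace ℝ (Fin d)) :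
    cosTransform (fun f => δ * q f) t = δ * cosTransform q t := by
  simp only [cosTransform, mul_assoc, integral_const_mul]

theorem cosTransform_comp_inv_smul (q : EuclideanSpace ℝ (Fin d) → ℝ) {M : ℝ} (hM : 0 < M)
    (t : EuclideanSpace ℝ (Fin d)) :
    cosTransform (fun f => q (M⁻¹ • f)) t = M ^ d * cosTransform q (M • t) := by
  have h := Measure.integral_comp_inv_smul_of_nonneg
    (μ := (volume : Measure (EuclideanSpace ℝ (Fin d))))
    (fun f => q f * Real.cos (inner ℝ f (M • t))) hM.le
  rw [finrank_euclideanSpace_fin, smul_eq_mul] at h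
  rw [cosTransform, cosTransform, ← h]
  simp only [inner_smul_left, inner_smul_right, conj_trivial, mul_inv_cancel_left₀ hM.ne']

theorem cosTransform_eq_re_fourier (hq : Integrable q) (t : EuclideanSpace ℝ (Fin d)) :
    cosTransform q t
      = (FourierTransform.fourier (fun f => (q f : ℂ)) ((2 * Real.pi)⁻¹ • t)).re := by
  have harg : ∀ f : EuclideanSpace ℝ (Fin d),
      -2 * Real.pi * inner ℝ f ((2 * Real.pi)⁻¹ • t) = -inner ℝ f t := fun f => by
    rw [inner_smul_right]
    field_simp
  rw [Real.fourier_eq', ← RCLike.re_eq_complex_re, ← integral_re]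
  · refine integral_congr_ae (Eventually.of_forall fun f => ?_)
    simp only [smul_eq_mul, harg]
    rw [RCLike.re_eq_complex_re, Complex.re_mul_ofReal, Complex.exp_ofReal_mul_I_re,
      Real.cos_neg, mul_comm]
  · refine (hq.ofReal (𝕜 := ℂ)).bdd_mul (c := 1)
      (Continuous.aestronglyMeasurable (by fun_prop)) ?_
    exact Eventually.of_forall fun f => (Complex.norm_exp_ofReal_mul_I _).le

theorem exists_norm_pow_mul_abs_cosTransform_le (hq : ContDiff ℝ (⊤ : ℕ∞) q)
    (hcs : HasCompactSupport q) (k : ℕ) : ∃ D : ℝ, ∀ t, ‖t‖ ^ k * |cosTransform q t| ≤ D := by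
  have hcs' : HasCompactSupport fun f => (q f : ℂ) :=
    hcs.comp_left (g := fun r : ℝ => (r : ℂ)) Complex.ofReal_zero
  let Φ : SchwartzMap (EuclideanSpace ℝ (Fin d)) ℂ :=
    hcs'.toSchwartzMap (Complex.ofRealCLM.contDiff.comp hq)
  obtain ⟨D, -, hD⟩ := (FourierTransform.fourier Φ).decay k 0
  refine ⟨(2 * Real.pi) ^ k * D, fun t => ?_⟩
  have hre : |cosTransform q t| ≤ ‖(FourierTransform.fourier Φ) ((2 * Real.pi)⁻¹ • t)‖ := by
    rw [cosTransform_eq_re_fourier (hq.continuous.integrable_of_hasCompactSupport hcs)]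
    exact Complex.abs_re_le_norm _
  calc ‖t‖ ^ k * |cosTransform q t|
      ≤ ‖t‖ ^ k * ‖(FourierTransform.fourier Φ) ((2 * Real.pi)⁻¹ • t)‖ := by gcongr
    _ = (2 * Real.pi) ^ k * (‖(2 * Real.pi)⁻¹ • t‖ ^ k *
          ‖iteratedFDeriv ℝ 0 (FourierTransform.fourier Φ) ((2 * Real.pi)⁻¹ • t)‖) := by
        rw [norm_iteratedFDeriv_zero, norm_smul, norm_inv, Real.norm_of_nonneg Real.two_pi_pos.le,
          ← mul_assoc, ← mul_pow, mul_inv_cancel_left₀ Real.two_pi_pos.ne']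
    _ ≤ (2 * Real.pi) ^ k * D := by
        gcongr
        exact hD _

/-- Dilating a bump function by a large factor concentrates its cosine transform near the origin. -/
theorem exists_concentrated_cosTransform (d : ℕ) {η : ℝ} (hη : 0 < η) :
    ∃ q : EuclideanSpace ℝ (Fin d) → ℝ, Integrable q ∧ HasCompactSupport q ∧ (∀ f, q f ≤ 1) ∧
      0 < cosTransform q 0 ∧
      ∀ t, ‖t‖ ^ (d + 1) * |cosTransform q t| ≤ η * cosTransform q 0 := by
  let φ : ContDiffBump (0 : EuclideanSpace ℝ (Fin d)) := ⟨1, 2, one_pos, one_lt_two⟩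
  have hφint : Integrable φ := φ.continuous.integrable_of_hasCompactSupport φ.hasCompactSupport
  have hpos : 0 < cosTransform φ 0 := by
    simp only [cosTransform, inner_zero_right, Real.cos_zero, mul_one]
    exact φ.integral_pos
  obtain ⟨D, hD⟩ := exists_norm_pow_mul_abs_cosTransform_le φ.contDiff φ.hasCompactSupport (d + 1)
  obtain ⟨M, hM1, hM⟩ : ∃ M : ℝ, 1 ≤ M ∧ D ≤ η * cosTransform φ 0 * M := by
    refine ⟨max 1 (D / (η * cosTransform φ 0)), le_max_left _ _, ?_⟩
    rw [← div_le_iff₀' (by positivity)]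
    exact le_max_right _ _
  have hM0 : 0 < M := one_pos.trans_le hM1
  refine ⟨fun f => φ (M⁻¹ • f), (integrable_comp_smul_iff volume _ (by positivity)).2 hφint,
    φ.hasCompactSupport.comp_smul (inv_ne_zero hM0.ne'), fun f => φ.le_one, ?_, fun t => ?_⟩
  · rw [cosTransform_comp_inv_smul _ hM0, smul_zero]
    positivity
  rw [cosTransform_comp_inv_smul _ hM0, cosTransform_comp_inv_smul _ hM0, smul_zero, abs_mul,
    abs_of_pos (pow_pos hM0 d)]
  refine le_of_mul_le_mul_left ?_ hM0
  calc M * (‖t‖ ^ (d + 1) * (M ^ d * |cosTransform φ (M • t)|))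
      = ‖M • t‖ ^ (d + 1) * |cosTransform φ (M • t)| := by
        rw [norm_smul, Real.norm_of_nonneg hM0.le]
        ring
    _ ≤ η * cosTransform φ 0 * M := (hD _).trans hM
    _ = M * (η * cosTransform φ 0) := by ring
    _ ≤ M * (η * (M ^ d * cosTransform φ 0)) := by
        gcongr
        exact le_mul_of_one_le_left hpos.le (one_le_pow₀ hM1)

end CosTransform
section Coercivity

theorem abs_dotProduct_mulVec_le {ι : Type*} [Fintype ι] [DecidableEq ι] (A : Matrix ι ι ℝ)
    (x : ι → ℝ) : |x ⬝ᵥ (A *ᵥ x)| ≤ ‖A‖ * (x ⬝ᵥ x) := by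
  have h := (l2_opNorm_le_iff (norm_nonneg A)).1 le_rfl x
  refine abs_le_of_sq_le_sq ?_ (mul_nonneg (norm_nonneg A) (dotProduct_self_nonneg x))
  calc (x ⬝ᵥ (A *ᵥ x)) ^ 2 ≤ (x ⬝ᵥ x) * ((A *ᵥ x) ⬝ᵥ (A *ᵥ x)) := by
        simpa only [dotProduct, sq] using Finset.sum_mul_sq_le_sq_mul_sq Finset.univ x (A *ᵥ x)
    _ ≤ (x ⬝ᵥ x) * (‖A‖ ^ 2 * (x ⬝ᵥ x)) := mul_le_mul_of_nonneg_left h (dotProduct_self_nonneg x)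
    _ = (‖A‖ * (x ⬝ᵥ x)) ^ 2 := by ring

theorem IsCoerciveWith.smul {ι : Type*} [Fintype ι] {A : Matrix ι ι ℝ} {c δ : ℝ} (hδ : 0 ≤ δ)
    (h : IsCoerciveWith c A) : IsCoerciveWith (δ * c) (δ • A) := fun x => by
  rw [smul_mulVec, dotProduct_smul, smul_eq_mul, mul_assoc]
  exact mul_le_mul_of_nonneg_left (h x) hδ

theorem isCoerciveWith_of_diagonally_dominant {ι : Type*} [Fintype ι] [DecidableEq ι]
    {A : Matrix ι ι ℝ} {c : ℝ} (hc : 0 ≤ c) (hdiag : ∀ i, A i i = 2 * c)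
    (hrow : ∀ i, ∑ j, (if i = j then 0 else |A i j|) ≤ c)
    (hcol : ∀ j, ∑ i, (if i = j then 0 else |A i j|) ≤ c) : IsCoerciveWith c A := fun x => by
  let N : Matrix ι ι ℝ := A - (2 * c) • 1
  have habs : ∀ i j, |N i j| = if i = j then 0 else |A i j| := fun i j => by
    rcases eq_or_ne i j with rfl | h
    · simp [N, hdiag]
    · simp [N, h]
  have hN : ‖N‖ ≤ c := l2_opNorm_le_of_row_col_sum hc
    (fun i => by simpa only [habs] using hrow i) (fun j => by simpa only [habs] using hcol j)
  have hquad : |x ⬝ᵥ (N *ᵥ x)| ≤ c * (x ⬝ᵥ x) := (abs_dotProduct_mulVec_le N x).trans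
    (mul_le_mul_of_nonneg_right hN (dotProduct_self_nonneg x))
  have hA : x ⬝ᵥ (A *ᵥ x) = x ⬝ᵥ (N *ᵥ x) + 2 * c * (x ⬝ᵥ x) := by
    rw [sub_mulVec, smul_mulVec, one_mulVec, dotProduct_sub, dotProduct_smul, smul_eq_mul,
      sub_add_cancel]
  linarith [(abs_le.1 hquad).1]

theorem dotProduct_mulVec_of {ι : Type*} [Fintype ι] (k : ι → ι → ℝ) (x : ι → ℝ) :
    x ⬝ᵥ (Matrix.of k *ᵥ x) = ∑ i, ∑ j, x i * x j * k i j := by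
  simp only [dotProduct, mulVec, Matrix.of_apply, Finset.mul_sum]
  exact Finset.sum_congr rfl fun i _ => Finset.sum_congr rfl fun j _ => by ring

theorem sum_mul_cos_sub_nonneg {ι : Type*} [Fintype ι] (c a : ι → ℝ) :
    0 ≤ ∑ i, ∑ j, c i * c j * Real.cos (a i - a j) := by
  have h : ∑ i, ∑ j, c i * c j * Real.cos (a i - a j)
      = (∑ i, c i * Real.cos (a i)) ^ 2 + (∑ i, c i * Real.sin (a i)) ^ 2 := by
    simp only [sq, Finset.sum_mul_sum, ← Finset.sum_add_distrib, Real.cos_sub]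
    exact Finset.sum_congr rfl fun i _ => Finset.sum_congr rfl fun j _ => by ring
  rw [h]
  positivity

variable {d : ℕ} {q h : EuclideanSpace ℝ (Fin d) → ℝ}

theorem sum_mul_cosTransform_sub_nonneg {ι : Type*} [Fintype ι] (hh : Integrable h)
    (hnonneg : ∀ f, 0 ≤ h f) (c : ι → ℝ) (y : ι → EuclideanSpace ℝ (Fin d)) :
    0 ≤ ∑ i, ∑ j, c i * c j * cosTransform h (y i - y j) := by
  have hterm : ∀ i j, Integrable fun f => c i * c j * (h f * Real.cos (inner ℝ f (y i - y j))) :=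
    fun i j => (integrable_mul_cos hh _).const_mul _
  have heq : ∑ i, ∑ j, c i * c j * cosTransform h (y i - y j)
      = ∫ f, h f * ∑ i, ∑ j, c i * c j * Real.cos (inner ℝ f (y i) - inner ℝ f (y j)) := by
    simp only [cosTransform, ← integral_const_mul]
    rw [← Finset.sum_congr rfl fun i _ => integral_finsetSum _ fun j _ => hterm i j,
      ← integral_finsetSum _ fun i _ => integrable_finsetSum _ fun j _ => hterm i j]
    simp only [Finset.mul_sum, mul_left_comm (h _), inner_sub_right]
  rw [heq]
  exact integral_nonneg fun f => mul_nonneg (hnonneg f) (sum_mul_cos_sub_nonneg c _)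

theorem IsCoerciveWith.of_cosTransform_le {ι : Type*} [Fintype ι] {c : ℝ} (hq : Integrable q)
    (hh : Integrable h) (hle : ∀ f, q f ≤ h f) {y : ι → EuclideanSpace ℝ (Fin d)}
    (hc : IsCoerciveWith c (Matrix.of fun i j => cosTransform q (y i - y j))) :
    IsCoerciveWith c (Matrix.of fun i j => cosTransform h (y i - y j)) := fun x => by
  have hdiff := sum_mul_cosTransform_sub_nonneg (hh.sub hq) (fun f => sub_nonneg.2 (hle f)) x y
  refine (hc x).trans (sub_nonneg.1 (hdiff.trans_eq ?_))
  rw [dotProduct_mulVec_of, dotProduct_mulVec_of]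
  simp only [← Finset.sum_sub_distrib, ← mul_sub, ← cosTransform_sub hh hq, Pi.sub_def]

theorem exists_isCoerciveWith_cosTransform (d : ℕ) {s : ℝ} (hs : 0 < s) :
    ∃ q : EuclideanSpace ℝ (Fin d) → ℝ, Integrable q ∧ HasCompactSupport q ∧ (∀ f, q f ≤ 1) ∧
      ∃ c : ℝ, 0 < c ∧ ∀ {ι : Type u} [Fintype ι]
        {u : ι → Fin d → ℤ} {y : ι → EuclideanSpace ℝ (Fin d)}, Function.Injective u →
        (∀ i j, s * ‖u i - u j‖ ≤ ‖y i - y j‖) →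
        IsCoerciveWith c (Matrix.of fun i j => cosTransform q (y i - y j)) := by
  have hA := tsum_decayProfile_pos (d := d) hs
  set A : ℝ := ∑' w : Fin d → ℤ, decayProfile d s w
  set B : ℝ := 1 + (s ^ (d + 1))⁻¹
  have hB : 0 < B := by positivity
  obtain ⟨q, hqint, hqcs, hq1, hq0, hdecay⟩ :=
    exists_concentrated_cosTransform d (η := (2 * (A * B))⁻¹) (by positivity)
  refine ⟨q, hqint, hqcs, hq1, cosTransform q 0 / 2, by positivity, fun {ι _ u y} hu hy => ?_⟩
  classical
  have hoff : ∀ i j, (if i = j then 0 else |cosTransform q (y i - y j)|)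
      ≤ (2 * A)⁻¹ * cosTransform q 0 * decayProfile d s (u i - u j) := fun i j => by
    split_ifs with hij
    · have := decayProfile_pos hs (u i - u j)
      positivity
    have hw : u i - u j ≠ 0 := sub_ne_zero.2 (hu.ne hij)
    have hy0 : 0 < ‖y i - y j‖ := (mul_pos hs (norm_pos_iff.2 hw)).trans_le (hy i j)
    calc |cosTransform q (y i - y j)|
        ≤ (2 * (A * B))⁻¹ * cosTransform q 0 * (‖y i - y j‖ ^ (d + 1))⁻¹ := by
          rw [← div_eq_mul_inv, le_div_iff₀' (by positivity)]
          exact hdecay _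
      _ ≤ (2 * (A * B))⁻¹ * cosTransform q 0 * (B * decayProfile d s (u i - u j)) := by
          gcongr
          exact inv_norm_pow_le_mul_decayProfile hs hw (hy i j)
      _ = (2 * A)⁻¹ * cosTransform q 0 * decayProfile d s (u i - u j) := by field_simp
  have hsum : ∀ {S : ℝ}, S ≤ A → (2 * A)⁻¹ * cosTransform q 0 * S ≤ cosTransform q 0 / 2 :=
    fun {S} hS => calc
      _ ≤ (2 * A)⁻¹ * cosTransform q 0 * A := by gcongr
      _ = cosTransform q 0 / 2 := by field_simp
  refine isCoerciveWith_of_diagonally_dominant (by positivity) (fun i => ?_) (fun i => ?_)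
    fun j => ?_
  · rw [Matrix.of_apply, sub_self]
    ring
  · refine (Finset.sum_le_sum fun j _ => hoff i j).trans ?_
    rw [← Finset.mul_sum]
    exact hsum (sum_decayProfile_sub_left_le hs hu _)
  · refine (Finset.sum_le_sum fun i _ => hoff i j).trans ?_
    rw [← Finset.mul_sum]
    exact hsum (sum_decayProfile_sub_right_le hs hu _)

end Coercivity

section SpectralDensity

variable {d p : ℕ} {a b : ℝ} {K : (Fin p → ℝ) → EuclideanSpace ℝ (Fin d) → ℝ}

theorem isCompact_paramSet : IsCompact (paramSet p a b) := by
  have h : paramSet p a b = Set.pi Set.univ fun _ => Set.Icc a b := by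
    ext θ
    exact (Set.mem_univ_pi).symm
  rw [h]
  exact isCompact_univ_pi fun _ => isCompact_Icc

theorem ModelCondition.eq_cosTransform (hK : ModelCondition a b K) {θ : Fin p → ℝ}
    (hθ : θ ∈ paramSet p a b) (t : EuclideanSpace ℝ (Fin d)) :
    K θ t = cosTransform (fun f => (fourierHat (K θ) f).re) t := by
  have hwave : Integrable fun f : EuclideanSpace ℝ (Fin d) =>
      fourierHat (K θ) f * Complex.exp (Complex.I * (inner ℝ f t : ℝ)) := by
    refine (hK.integrable_hat θ hθ).mul_bdd (c := 1)
      (Continuous.aestronglyMeasurable (by fun_prop)) (Eventually.of_forall fun f => ?_)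
    rw [mul_comm, Complex.norm_exp_ofReal_mul_I]
  rw [← Complex.ofReal_re (K θ t), hK.inversion θ hθ t, ← RCLike.re_eq_complex_re,
    ← integral_re hwave]
  refine integral_congr_ae (Eventually.of_forall fun f => ?_)
  simp only [RCLike.re_eq_complex_re]
  rw [Complex.mul_re, (hK.positive_hat θ hθ f).1, mul_comm Complex.I, Complex.exp_ofReal_mul_I_re,
    zero_mul, sub_zero]

theorem ModelCondition.exists_le_re_fourierHat (hK : ModelCondition a b K)
    {Z : Set (EuclideanSpace ℝ (Fin d))} (hZ : IsCompact Z) :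
    ∃ δ : ℝ, 0 < δ ∧ ∀ θ ∈ paramSet p a b, ∀ f ∈ Z, δ ≤ (fourierHat (K θ) f).re := by
  obtain ⟨δ, hδ, hle⟩ := (hZ.prod (isCompact_paramSet (p := p) (a := a) (b := b))).exists_forall_le'
    (Complex.continuous_re.comp_continuousOn (hK.continuous_hat.mono
      (Set.prod_mono (Set.subset_univ _) le_rfl)))
    fun z hz => (hK.positive_hat z.2 hz.2 z.1).2
  exact ⟨δ, hδ, fun θ hθ f hf => hle (f, θ) ⟨hf, hθ⟩⟩

theorem ModelCondition.exists_isCoerciveWith (hK : ModelCondition a b K) {s : ℝ} (hs : 0 < s) :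
    ∃ c : ℝ, 0 < c ∧ ∀ θ ∈ paramSet p a b, ∀ {ι : Type u} [Fintype ι]
      {u : ι → Fin d → ℤ} {y : ι → EuclideanSpace ℝ (Fin d)}, Function.Injective u →
      (∀ i j, s * ‖u i - u j‖ ≤ ‖y i - y j‖) →
      IsCoerciveWith c (Matrix.of fun i j => K θ (y i - y j)) := by
  obtain ⟨q, hqint, hqcs, hq1, c, hc, hcoer⟩ := exists_isCoerciveWith_cosTransform.{u} d hs
  obtain ⟨δ, hδ, hδle⟩ := hK.exists_le_re_fourierHat hqcs
  refine ⟨δ * c, by positivity, fun θ hθ ι _ u y hu hy => ?_⟩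
  have hle : ∀ f, δ * q f ≤ (fourierHat (K θ) f).re := fun f => by
    by_cases hf : f ∈ tsupport q
    · exact (mul_le_of_le_one_right hδ.le (hq1 f)).trans (hδle θ hθ f hf)
    · rw [image_eq_zero_of_notMem_tsupport hf, mul_zero]
      exact (hK.positive_hat θ hθ f).2.le
  simp only [hK.eq_cosTransform hθ]
  refine IsCoerciveWith.of_cosTransform_le (hqint.const_mul δ) (hK.integrable_hat θ hθ).re hle ?_
  simp only [cosTransform_const_mul]
  exact (hcoer hu hy).smul hδ.le

end SpectralDensity

section Covariance

variable {d p : ℕ} {a b : ℝ} {K : (Fin p → ℝ) → EuclideanSpace ℝ (Fin d) → ℝ}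

theorem ModelCondition.exists_decay (hK : ModelCondition a b K) :
    ∃ D : ℝ, 0 < D ∧ ∀ I : List (Fin p), I.length ≤ 3 → ∀ θ ∈ paramSet p a b, ∀ t,
      |iterPartial a b I (fun θ' => K θ' t) θ| ≤ D / (1 + ‖t‖ ^ (d + 1)) := by
  choose! C hC using hK.decay
  obtain ⟨D, hD⟩ := ((List.finite_length_le (Fin p) 3).image C).bddAbove
  refine ⟨max D 1, by positivity, fun I hI θ hθ t => (hC I hI θ hθ t).trans ?_⟩
  gcongr
  exact (hD ⟨I, hI, rfl⟩).trans (le_max_left _ _)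

variable {ι : Type*}

/-- The covariance matrix of the observations at the points `u_i + ε x_i`, together with its
entrywise partial derivatives: the entry at `I` is the matrix `R_θ^I`. -/
def covFamily (a b : ℝ) (K : (Fin p → ℝ) → EuclideanSpace ℝ (Fin d) → ℝ) (ε : ℝ)
    (θ : Fin p → ℝ) (u : ι → Fin d → ℤ) (x : ι → EuclideanSpace ℝ (Fin d))
    (I : List (Fin p)) : Matrix ι ι ℝ :=
  Matrix.of fun i j =>
    iterPartial a b I (fun θ' => K θ' (gridPoint ε u x i - gridPoint ε u x j)) θ

theorem covFamily_add_const (ε : ℝ) (θ : Fin p → ℝ) (u : ι → Fin d → ℤ)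
    (x : ι → EuclideanSpace ℝ (Fin d)) (z : Fin d → ℤ) :
    covFamily a b K ε θ (fun i => u i + z) x = covFamily a b K ε θ u x := by
  have hdiff : ∀ i j, gridPoint ε (fun i => u i + z) x i - gridPoint ε (fun i => u i + z) x j
      = gridPoint ε u x i - gridPoint ε u x j := fun i j => by
    ext k
    simp [gridPoint]
    ring
  funext I
  simp only [covFamily, hdiff]

theorem ModelCondition.exists_abs_covFamily_le (hK : ModelCondition a b K) {ε : ℝ}
    (hε : ε ∈ Set.Ico (0 : ℝ) (1 / 2)) :
    ∃ D : ℝ, 0 < D ∧ ∀ θ ∈ paramSet p a b, ∀ {ι : Type u} (u : ι → Fin d → ℤ)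
      {x : ι → EuclideanSpace ℝ (Fin d)}, (∀ i k, |x i k| ≤ 1) →
      ∀ I : List (Fin p), I.length ≤ 3 → ∀ i j,
        |covFamily a b K ε θ u x I i j| ≤ D * decayProfile d (1 - 2 * ε) (u i - u j) := by
  obtain ⟨D, hD, hdecay⟩ := hK.exists_decay
  refine ⟨D, hD, fun θ hθ ι u x hx I hI i j => (hdecay I hI θ hθ _).trans ?_⟩
  have : 0 ≤ 1 - 2 * ε := by linarith [hε.2]
  rw [decayProfile, mul_one_div]
  gcongr
  exact le_norm_gridPoint_sub hε.1 u hx i j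

theorem ModelCondition.exists_regularFamily (hK : ModelCondition a b K) {ε : ℝ}
    (hε : ε ∈ Set.Ico (0 : ℝ) (1 / 2)) :
    ∃ c C : ℝ, 0 < c ∧ 0 < C ∧ ∀ θ ∈ paramSet p a b, ∀ {ι : Type u} [Fintype ι] [DecidableEq ι]
      {u : ι → Fin d → ℤ} {x : ι → EuclideanSpace ℝ (Fin d)}, Function.Injective u →
      (∀ i k, |x i k| ≤ 1) → RegularFamily c C (covFamily a b K ε θ u x) := by
  have hs : 0 < 1 - 2 * ε := by linarith [hε.2]
  obtain ⟨c, hc, hcoer⟩ := hK.exists_isCoerciveWith.{u} hs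
  obtain ⟨D, hD, hdecay⟩ := hK.exists_abs_covFamily_le.{u} hε
  have hC : 0 < D * ∑' w, decayProfile d (1 - 2 * ε) w := mul_pos hD (tsum_decayProfile_pos hs)
  refine ⟨c, _, hc, hC, fun θ hθ ι _ _ u x hu hx => ⟨fun I hI => ?_, ?_⟩⟩
  · refine l2_opNorm_le_of_row_col_sum hC.le (fun i => ?_) fun j => ?_
    · refine (Finset.sum_le_sum fun j _ => hdecay θ hθ u hx I hI i j).trans ?_
      rw [← Finset.mul_sum]
      exact mul_le_mul_of_nonneg_left (sum_decayProfile_sub_left_le hs hu _) hD.le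
    · refine (Finset.sum_le_sum fun i _ => hdecay θ hθ u hx I hI i j).trans ?_
      rw [← Finset.mul_sum]
      exact mul_le_mul_of_nonneg_left (sum_decayProfile_sub_right_le hs hu _) hD.le
  · exact hcoer θ hθ hu (le_norm_gridPoint_sub hε.1 u hx)

theorem ModelCondition.exists_norm_wordEval_covFamily_le (hK : ModelCondition a b K) {ε : ℝ}
    (hε : ε ∈ Set.Ico (0 : ℝ) (1 / 2)) (w : List (FactorLabel p)) :
    ∃ B : ℝ, 0 ≤ B ∧ ∀ θ ∈ paramSet p a b, ∀ {ι : Type u} [Fintype ι] [DecidableEq ι]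
      {u : ι → Fin d → ℤ} {x : ι → EuclideanSpace ℝ (Fin d)}, Function.Injective u →
      (∀ i k, |x i k| ≤ 1) → ‖wordEval (covFamily a b K ε θ u x) w‖ ≤ B := by
  obtain ⟨c, C, hc, hC, hreg⟩ := hK.exists_regularFamily.{u} hε
  obtain ⟨B, hB⟩ := exists_traceClose_wordEval.{u} hc hC w
  refine ⟨max B 0, le_max_right _ _, fun θ hθ ι _ _ u x hu hx => ?_⟩
  have hself := hB (hreg θ hθ hu hx) (hreg θ hθ hu hx) le_rfl fun I _ A => by
    rw [sub_self, Matrix.zero_mul, trace_zero, abs_zero, zero_mul]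
  exact hself.norm_left.trans (le_max_left _ _)

variable {κ : Type*} [Fintype ι] [DecidableEq ι] [Fintype κ] [DecidableEq κ]

/-- The trace of the product of factors described by `w`, for the covariance matrix at the points
`u_i + ε x_i`. -/
def covTrace (a b : ℝ) (K : (Fin p → ℝ) → EuclideanSpace ℝ (Fin d) → ℝ) (ε : ℝ) (θ : Fin p → ℝ)
    (w : List (FactorLabel p)) (u : ι → Fin d → ℤ) (x : ι → EuclideanSpace ℝ (Fin d)) : ℝ :=
  (wordEval (covFamily a b K ε θ u x) w).trace

theorem covTrace_comp_equiv (ε : ℝ) (θ : Fin p → ℝ) (w : List (FactorLabel p))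
    (u : ι → Fin d → ℤ) (x : ι → EuclideanSpace ℝ (Fin d)) (e : κ ≃ ι) :
    covTrace a b K ε θ w (u ∘ e) (x ∘ e) = covTrace a b K ε θ w u x := by
  rw [covTrace, covTrace, ← trace_submatrix_equiv _ e, ← wordEval_submatrix]
  rfl

theorem covTrace_add_const (ε : ℝ) (θ : Fin p → ℝ) (w : List (FactorLabel p))
    (u : ι → Fin d → ℤ) (x : ι → EuclideanSpace ℝ (Fin d)) (z : Fin d → ℤ) :
    covTrace a b K ε θ w (fun i => u i + z) x = covTrace a b K ε θ w u x := by
  rw [covTrace, covTrace, covFamily_add_const]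

theorem ModelCondition.exists_abs_covTrace_le (hK : ModelCondition a b K) {ε : ℝ}
    (hε : ε ∈ Set.Ico (0 : ℝ) (1 / 2)) (w : List (FactorLabel p)) :
    ∃ B : ℝ, 0 ≤ B ∧ ∀ θ ∈ paramSet p a b, ∀ {ι : Type u} [Fintype ι] [DecidableEq ι]
      {u : ι → Fin d → ℤ} {x : ι → EuclideanSpace ℝ (Fin d)}, Function.Injective u →
      (∀ i k, |x i k| ≤ 1) → |covTrace a b K ε θ w u x| ≤ B * Fintype.card ι := by
  obtain ⟨B, hB0, hB⟩ := hK.exists_norm_wordEval_covFamily_le.{u} hε w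
  refine ⟨B, hB0, fun θ hθ ι _ _ u x hu hx => (abs_trace_le_card_mul_l2_opNorm _).trans ?_⟩
  rw [mul_comm]
  exact mul_le_mul_of_nonneg_right (hB θ hθ hu hx) (Nat.cast_nonneg _)

theorem ModelCondition.exists_abs_covTrace_sub_sum_fibre_le (hK : ModelCondition a b K) {ε : ℝ}
    (hε : ε ∈ Set.Ico (0 : ℝ) (1 / 2)) (w : List (FactorLabel p)) :
    ∃ B : ℝ, 0 ≤ B ∧ ∀ θ ∈ paramSet p a b, ∀ {ι : Type u} {κ : Type v} [Fintype ι]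
      [DecidableEq ι] [Fintype κ] [DecidableEq κ] (π : ι → κ) {u : ι → Fin d → ℤ}
      {x : ι → EuclideanSpace ℝ (Fin d)}, Function.Injective u → (∀ i k, |x i k| ≤ 1) →
      |covTrace a b K ε θ w u x - ∑ k, covTrace a b K ε θ w
        (fun i : {i // π i = k} => u i) (fun i : {i // π i = k} => x i)|
      ≤ B * ∑ i, ∑ j, if π i = π j then 0 else decayProfile d (1 - 2 * ε) (u i - u j) := by
  have hs : 0 < 1 - 2 * ε := by linarith [hε.2]
  obtain ⟨c, C, hc, hC, hreg⟩ := hK.exists_regularFamily.{u} hε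
  obtain ⟨D, hD, hdecay⟩ := hK.exists_abs_covFamily_le.{u} hε
  obtain ⟨B, hB⟩ := exists_abs_trace_wordEval_sub_sum_blockAt_le.{u, v} hc hC w
  refine ⟨max B 0 * D, by positivity, fun θ hθ ι κ _ _ _ _ π u x hu hx => ?_⟩
  have hcross :
      0 ≤ ∑ i, ∑ j, if π i = π j then 0 else decayProfile d (1 - 2 * ε) (u i - u j) :=
    Finset.sum_nonneg fun i _ => Finset.sum_nonneg fun j _ => by
      split_ifs
      exacts [le_rfl, (decayProfile_pos hs _).le]
  refine (hB π (hreg θ hθ hu hx) (mul_nonneg hD.le hcross) fun I hI => ?_).trans ?_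
  · simp only [Finset.mul_sum, mul_ite, mul_zero]
    refine Finset.sum_le_sum fun i _ => Finset.sum_le_sum fun j _ => ?_
    split_ifs
    exacts [le_rfl, hdecay θ hθ u hx I hI i j]
  · rw [mul_assoc]
    exact mul_le_mul_of_nonneg_right (le_max_left _ _) (mul_nonneg hD.le hcross)

end Covariance

section GridSequence

variable {d p n : ℕ} {a b : ℝ} {K : (Fin p → ℝ) → EuclideanSpace ℝ (Fin d) → ℝ}

/-- The grid positions `v_i`, as points of `ℤ^d`. -/
def intGrid (v : ℕ → Fin d → ℕ) (i : ℕ) : Fin d → ℤ := fun k => (v i k : ℤ)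

theorem intGrid_injective {v : ℕ → Fin d → ℕ} (hv : Function.Injective v) :
    Function.Injective (intGrid v) := fun _ _ h =>
  hv (funext fun k => Int.ofNat.inj (congrFun h k))

theorem IsGridSequence.image_range {v : ℕ → Fin d → ℕ} (hv : IsGridSequence v) {N : ℕ}
    (hN : 1 ≤ N) :
    (Finset.range (N ^ d)).image v = Fintype.piFinset fun _ => Finset.Icc 1 N := by
  apply Finset.coe_injective
  rw [Finset.coe_image, show ((Finset.range (N ^ d) : Finset ℕ) : Set ℕ) = {i | i < N ^ d} by
    ext; simp, hv N hN]
  ext u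
  simp only [Set.mem_ofPred_eq, Finset.mem_coe, Fintype.mem_piFinset, Finset.mem_Icc]

theorem IsGridSequence.injective (hd : 1 ≤ d) {v : ℕ → Fin d → ℕ} (hv : IsGridSequence v) :
    Function.Injective v := by
  have hinjOn : ∀ N : ℕ, 1 ≤ N → Set.InjOn v (Finset.range (N ^ d)) := fun N hN =>
    Finset.card_image_iff.1 (by rw [hv.image_range hN, Fintype.card_piFinset]; simp)
  intro i j hij
  have hrange : ∀ m : ℕ, m ≤ i + j → m ∈ (Finset.range ((i + j + 1) ^ d) : Set ℕ) := fun m hm =>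
    Finset.mem_coe.2 (Finset.mem_range.2
      ((Nat.lt_succ_of_le hm).trans_le (Nat.le_self_pow (by omega) _)))
  exact hinjOn _ (Nat.le_add_left 1 _) (hrange i (by omega)) (hrange j (by omega)) hij

theorem ndMatrix_eq_ndEval (v : ℕ → Fin d → ℕ) (ε : ℝ) (x : Fin n → EuclideanSpace ℝ (Fin d))
    (θ : Fin p → ℝ) :
    ndMatrix a b K v ε x θ = ndEval (covFamily a b K ε θ (fun i : Fin n => intGrid v i) x) := by
  have hpt : gridPoint ε (fun i : Fin n => intGrid v i) x = obsPoint v ε x := by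
    funext i
    ext k
    simp [gridPoint, obsPoint, intGrid]
  have hcov : ∀ I : List (Fin p), (Matrix.of fun i j => iterPartial a b I
      (fun θ' => covMatrix K v ε x θ' i j) θ)
      = covFamily a b K ε θ (fun i : Fin n => intGrid v i) x I := fun I => by
    rw [covFamily, hpt]
    rfl
  funext I
  cases I with
  | deriv I hI => exact hcov I
  | inv => exact congrArg (·⁻¹) (hcov [])

theorem factorMatrix_eq_factorEval (v : ℕ → Fin d → ℕ) (ε : ℝ)
    (x : Fin n → EuclideanSpace ℝ (Fin d)) (θ : Fin p → ℝ) :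
    factorMatrix a b K v ε x θ
      = factorEval (covFamily a b K ε θ (fun i : Fin n => intGrid v i) x) := by
  funext s
  cases s with
  | nd I => exact congrFun (ndMatrix_eq_ndEval v ε x θ) I
  | sd =>
    have hinv := congrFun (ndMatrix_eq_ndEval (a := a) (b := b) (K := K) v ε x θ) NdIndex.inv
    exact congrArg (fun A : Matrix (Fin n) (Fin n) ℝ => (diagonal A.diag)⁻¹) hinv
  | bd L =>
    rw [factorMatrix, ndProduct, ndMatrix_eq_ndEval]
    rfl

theorem wordMatrix_eq_wordEval (v : ℕ → Fin d → ℕ) (ε : ℝ)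
    (x : Fin n → EuclideanSpace ℝ (Fin d)) (θ : Fin p → ℝ) (w : List (FactorLabel p)) :
    wordMatrix a b K v ε x θ w
      = wordEval (covFamily a b K ε θ (fun i : Fin n => intGrid v i) x) w := by
  rw [wordMatrix, factorMatrix_eq_factorEval, wordEval]

theorem normTrace_eq_covTrace_div (v : ℕ → Fin d → ℕ) (ε : ℝ)
    (x : Fin n → EuclideanSpace ℝ (Fin d)) (θ : Fin p → ℝ) (w : List (FactorLabel p)) :
    normTrace a b K v ε x θ w = covTrace a b K ε θ w (fun i : Fin n => intGrid v i) x / n := by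
  rw [normTrace, wordMatrix_eq_wordEval, one_div_mul_eq_div, covTrace]

theorem singularValues_toEuclideanLin_le_l2_opNorm {ι κ : Type*} [Fintype ι] [Fintype κ]
    [DecidableEq κ] (A : Matrix ι κ ℝ) (j : ℕ) :
    (Matrix.toEuclideanLin A).singularValues j ≤ ‖A‖ := by
  set T := Matrix.toEuclideanLin A
  rcases lt_or_ge j (Module.finrank ℝ (EuclideanSpace ℝ κ)) with hj | hj
  · obtain ⟨y, hy⟩ := (T.hasEigenvalue_adjoint_comp_self_sq_singularValues hj).exists_hasEigenvector
    have hsq : ‖T y‖ ^ 2 = (T.singularValues j * ‖y‖) ^ 2 := by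
      have hinner := congrArg (fun z => inner ℝ z y) hy.apply_eq_smul
      simp only [LinearMap.comp_apply, LinearMap.adjoint_inner_left, inner_smul_left,
        conj_trivial, real_inner_self_eq_norm_sq] at hinner
      rw [mul_pow]
      exact hinner
    have hnorm : T.singularValues j * ‖y‖ ≤ ‖A‖ * ‖y‖ := by
      rw [← (pow_left_inj₀ (norm_nonneg _)
        (mul_nonneg (T.singularValues_nonneg j) (norm_nonneg _)) two_ne_zero).1 hsq]
      exact Matrix.l2_opNorm_mulVec A y
    exact le_of_mul_le_mul_right hnorm (norm_pos_iff.2 hy.2)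
  · rw [T.singularValues_of_finrank_le hj]
    exact norm_nonneg _

theorem ModelCondition.exists_singularValues_wordMatrix_le (hd : 1 ≤ d)
    (hK : ModelCondition a b K) {ε : ℝ} (hε : ε ∈ Set.Ico (0 : ℝ) (1 / 2))
    (w : List (FactorLabel p)) :
    ∃ C : ℝ, ∀ θ ∈ paramSet p a b, ∀ v, IsGridSequence v → ∀ (n : ℕ)
      (x : Fin n → EuclideanSpace ℝ (Fin d)), (∀ i k, |x i k| ≤ 1) → ∀ j : ℕ,
        (Matrix.toEuclideanLin (wordMatrix a b K v ε x θ w)).singularValues j ≤ C := by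
  obtain ⟨B, -, hB⟩ := hK.exists_norm_wordEval_covFamily_le hε w
  refine ⟨B, fun θ hθ v hv n x hx j =>
    (singularValues_toEuclideanLin_le_l2_opNorm _ j).trans ?_⟩
  rw [wordMatrix_eq_wordEval]
  exact hB θ hθ ((intGrid_injective (hv.injective hd)).comp Fin.val_injective) hx

end GridSequence

section BoundaryLoss

variable {d : ℕ} {s : ℝ}

/-- The points of the box `{0, ..., L - 1}^d` that the shift by `w` moves out of the box. -/
def exitSet (d L : ℕ) (w : Fin d → ℤ) : Finset (Fin d → Fin L) :=
  {l | ¬ ∀ k, 0 ≤ (l k : ℤ) + w k ∧ (l k : ℤ) + w k < L}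

/-- The total `decayProfile` weight of the pairs made of a point of the box `{0, ..., L - 1}^d` and
a point outside, divided by the number of points of the box. It bounds the covariance per point
that is lost when distinct boxes are decoupled. -/
def boundaryLoss (d : ℕ) (s : ℝ) (L : ℕ) : ℝ :=
  ∑' w : Fin d → ℤ, decayProfile d s w * ((exitSet d L w).card / (L : ℝ) ^ d)

theorem card_filter_add_mem_range (L : ℕ) (z : ℤ) :
    Finset.card {a : Fin L | 0 ≤ (a : ℤ) + z ∧ (a : ℤ) + z < L} = L - z.natAbs := by
  have hcard : Finset.card {a : Fin L | 0 ≤ (a : ℤ) + z ∧ (a : ℤ) + z < L}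
      = (Finset.Ico (max 0 (-z)) (min L (L - z))).card := by
    refine Finset.card_nbij (fun a => (a : ℤ)) (fun a ha => ?_) (fun a _ a' _ h => ?_)
      fun m hm => ?_
    · have hshift := (Finset.mem_filter.1 ha).2
      have : (a : ℤ) < L := by exact_mod_cast a.2
      simp only [Finset.mem_coe, Finset.mem_Ico]
      omega
    · exact Fin.ext (Int.ofNat.inj h)
    · have hm := Finset.mem_Ico.1 hm
      refine ⟨⟨m.toNat, by omega⟩, ?_, by simp only; omega⟩
      simp only [Finset.coe_filter, Finset.mem_univ, true_and, Set.mem_ofPred_eq]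
      omega
  rw [hcard, Int.card_Ico]
  omega

theorem card_exitSet_add_prod (L : ℕ) (w : Fin d → ℤ) :
    (exitSet d L w).card + ∏ k, (L - (w k).natAbs) = L ^ d := by
  have hstay : Finset.card {l : Fin d → Fin L | ∀ k, 0 ≤ (l k : ℤ) + w k ∧ (l k : ℤ) + w k < L}
      = ∏ k, (L - (w k).natAbs) := by
    simp only [← card_filter_add_mem_range, ← Fintype.card_piFinset]
    congr 1
    ext l
    simp only [Finset.mem_filter, Finset.mem_univ, true_and, Fintype.mem_piFinset]
  rw [← hstay, exitSet, add_comm, Finset.card_filter_add_card_filter_not, Finset.card_univ,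
    Fintype.card_fun, Fintype.card_fin, Fintype.card_fin]

theorem card_exitSet_div_le_one (L : ℕ) (w : Fin d → ℤ) :
    ((exitSet d L w).card : ℝ) / (L : ℝ) ^ d ≤ 1 := by
  refine div_le_one_of_le₀ ?_ (by positivity)
  exact_mod_cast (Nat.le_add_right _ _).trans_eq (card_exitSet_add_prod L w)

theorem tendsto_natCast_tsub_div (m : ℕ) :
    Tendsto (fun L : ℕ => ((L - m : ℕ) : ℝ) / L) atTop (𝓝 1) := by
  have hlim : Tendsto (fun L : ℕ => 1 - (m : ℝ) / L) atTop (𝓝 1) := by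
    simpa using (tendsto_const_div_atTop_nhds_zero_nat (m : ℝ)).const_sub 1
  refine hlim.congr' ?_
  filter_upwards [eventually_ge_atTop m, eventually_ne_atTop 0] with L hm hL
  rw [Nat.cast_sub hm, one_sub_div (Nat.cast_ne_zero.2 hL)]

theorem tendsto_card_exitSet_div (w : Fin d → ℤ) :
    Tendsto (fun L : ℕ => ((exitSet d L w).card : ℝ) / (L : ℝ) ^ d) atTop (𝓝 0) := by
  have hstay : Tendsto (fun L : ℕ => 1 - ∏ k, ((L - (w k).natAbs : ℕ) : ℝ) / L) atTop (𝓝 0) := by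
    simpa using (tendsto_finsetProd Finset.univ fun k _ =>
      tendsto_natCast_tsub_div (w k).natAbs).const_sub 1
  refine hstay.congr' ?_
  filter_upwards [eventually_ne_atTop 0] with L hL
  have hsplit := congrArg (Nat.cast (R := ℝ)) (card_exitSet_add_prod L w)
  simp only [Nat.cast_add, Nat.cast_prod, Nat.cast_pow] at hsplit
  rw [Finset.prod_div_distrib, Finset.prod_const, Finset.card_univ, Fintype.card_fin,
    one_sub_div (pow_ne_zero _ (Nat.cast_ne_zero.2 hL)), ← hsplit, add_sub_cancel_right]

theorem boundaryLoss_nonneg (hs : 0 < s) (L : ℕ) : 0 ≤ boundaryLoss d s L :=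
  tsum_nonneg fun w => mul_nonneg (decayProfile_pos hs w).le (by positivity)

theorem tendsto_boundaryLoss (hs : 0 < s) : Tendsto (boundaryLoss d s) atTop (𝓝 0) := by
  rw [← tsum_zero (α := ℝ) (β := Fin d → ℤ)]
  refine tendsto_tsum_of_dominated_convergence (bound := decayProfile d s)
    (summable_decayProfile hs) (fun w => ?_) (Eventually.of_forall fun L w => ?_)
  · simpa only [mul_zero] using (tendsto_card_exitSet_div w).const_mul (decayProfile d s w)
  · rw [Real.norm_of_nonneg (mul_nonneg (decayProfile_pos hs w).le (by positivity))]
    exact mul_le_of_le_one_right (decayProfile_pos hs w).le (card_exitSet_div_le_one L w)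

end BoundaryLoss

section Boxes

variable {d k L : ℕ} {s : ℝ}

theorem eq_and_eq_of_mul_add_eq {β β' l l' : ℕ} (hl : l < L) (hl' : l' < L)
    (h : L * β + l = L * β' + l') : β = β' ∧ l = l' := by
  obtain ⟨hβ, hr⟩ := (Nat.div_mod_unique (Nat.zero_lt_of_lt hl)).2 ⟨add_comm l _, hl⟩
  obtain ⟨hβ', hr'⟩ := (Nat.div_mod_unique (Nat.zero_lt_of_lt hl)).2 ⟨add_comm l' _, hl'⟩
  rw [h] at hβ hr
  exact ⟨hβ.symm.trans hβ', hr.symm.trans hr'⟩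

/-- The point `L β + l` of the box `{0, ..., k L - 1}^d`, for the block number `β` and the position
`l` in that block. -/
def boxPoint (q : (Fin d → Fin k) × (Fin d → Fin L)) : Fin d → ℤ :=
  fun i => L * (q.1 i : ℤ) + (q.2 i : ℤ)

theorem boxPoint_injective : Function.Injective (boxPoint (d := d) (k := k) (L := L)) := by
  intro q q' h
  have hcoord : ∀ i, (q.1 i : ℕ) = q'.1 i ∧ (q.2 i : ℕ) = q'.2 i := fun i => by
    have hi := congrFun h i
    simp only [boxPoint] at hi
    exact eq_and_eq_of_mul_add_eq (q.2 i).2 (q'.2 i).2 (by exact_mod_cast hi)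
  exact Prod.ext (funext fun i => Fin.ext (hcoord i).1) (funext fun i => Fin.ext (hcoord i).2)

theorem mem_exitSet_boxPoint_sub {q q' : (Fin d → Fin k) × (Fin d → Fin L)} (h : q.1 ≠ q'.1) :
    q.2 ∈ exitSet d L (boxPoint q' - boxPoint q) := by
  refine Finset.mem_filter.2 ⟨Finset.mem_univ _, fun hstay => h (funext fun i => Fin.ext ?_)⟩
  have hi := hstay i
  simp only [Pi.sub_apply, boxPoint] at hi
  have hlt : ((q'.2 i : ℕ) : ℤ) < L := by exact_mod_cast (q'.2 i).2
  have hupper : (L : ℤ) * ((q'.1 i : ℕ) - (q.1 i : ℕ) : ℤ) < L * 1 := by linarith [hi.2]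
  have hlower : (L : ℤ) * (-1) < L * ((q'.1 i : ℕ) - (q.1 i : ℕ) : ℤ) := by linarith [hi.1]
  have := lt_of_mul_lt_mul_left hupper (Nat.cast_nonneg L)
  have := lt_of_mul_lt_mul_left hlower (Nat.cast_nonneg L)
  omega

theorem sum_row_boxPoint_le (hs : 0 < s) (q : (Fin d → Fin k) × (Fin d → Fin L)) :
    ∑ q' : (Fin d → Fin k) × (Fin d → Fin L),
      (if q.1 = q'.1 then 0 else decayProfile d s (boxPoint q - boxPoint q'))
      ≤ ∑' w, {w | q.2 ∈ exitSet d L w}.indicator (decayProfile d s) w := by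
  have hinj : Function.Injective fun q' : (Fin d → Fin k) × (Fin d → Fin L) =>
    boxPoint q' - boxPoint q := fun _ _ h => boxPoint_injective (sub_left_injective h)
  have hnonneg : ∀ w, 0 ≤ {w | q.2 ∈ exitSet d L w}.indicator (decayProfile d s) w :=
    Set.indicator_nonneg fun w _ => (decayProfile_pos hs w).le
  rw [← tsum_fintype (L := .unconditional _)]
  refine Summable.tsum_le_tsum_of_inj _ hinj (fun w _ => hnonneg w) (fun q' => ?_)
    (hasSum_fintype _).summable ((summable_decayProfile hs).indicator _)
  split_ifs with h
  · exact hnonneg _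
  · have hexit : boxPoint q' - boxPoint q ∈ {w | q.2 ∈ exitSet d L w} :=
      mem_exitSet_boxPoint_sub h
    rw [Set.indicator_of_mem hexit, ← decayProfile_neg, neg_sub]

theorem sum_tsum_indicator_exitSet (hs : 0 < s) (hL : 0 < L) :
    ∑ l : Fin d → Fin L, ∑' w, {w | l ∈ exitSet d L w}.indicator (decayProfile d s) w
      = (L : ℝ) ^ d * boundaryLoss d s L := by
  rw [← Summable.tsum_finsetSum fun l _ => (summable_decayProfile hs).indicator _, boundaryLoss,
    ← tsum_mul_left]
  refine tsum_congr fun w => ?_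
  simp only [Set.indicator_apply, Set.mem_ofPred_eq, Finset.sum_ite_mem, Finset.univ_inter,
    Finset.sum_const, nsmul_eq_mul]
  field_simp

theorem sum_cross_boxPoint_le (hs : 0 < s) (hL : 0 < L) :
    ∑ q : (Fin d → Fin k) × (Fin d → Fin L), ∑ q' : (Fin d → Fin k) × (Fin d → Fin L),
      (if q.1 = q'.1 then 0 else decayProfile d s (boxPoint q - boxPoint q'))
      ≤ ((k * L : ℕ) : ℝ) ^ d * boundaryLoss d s L := by
  refine (Finset.sum_le_sum fun q _ => sum_row_boxPoint_le hs q).trans (le_of_eq ?_)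
  rw [Fintype.sum_prod_type]
  dsimp only
  rw [sum_tsum_indicator_exitSet hs hL, Finset.sum_const, Finset.card_univ, Fintype.card_fun,
    Fintype.card_fin, Fintype.card_fin, nsmul_eq_mul]
  push_cast
  ring

end Boxes

section BoxEnumeration

variable {d : ℕ} {v : ℕ → Fin d → ℕ} {e : (Fin d → ℕ) ≃ ℕ}

/-- An enumeration of `ℕ^d` which, for every `N`, lists the points of the box `{0, ..., N - 1}^d`
first. -/
def IsBoxEnumeration (e : (Fin d → ℕ) ≃ ℕ) : Prop :=
  ∀ (N : ℕ) (y : Fin d → ℕ), e y < N ^ d ↔ ∀ k, y k < N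

theorem IsGridSequence.lt_pow_iff (hd : 1 ≤ d) (hv : IsGridSequence v) {N : ℕ} (hN : 1 ≤ N)
    (i : ℕ) : i < N ^ d ↔ ∀ k, 1 ≤ v i k ∧ v i k ≤ N := by
  have hmem := (hv.injective hd).mem_set_image (s := {i | i < N ^ d}) (a := i)
  rw [hv N hN] at hmem
  exact hmem.symm

theorem IsGridSequence.one_le_apply (hd : 1 ≤ d) (hv : IsGridSequence v) (i : ℕ) (k : Fin d) :
    1 ≤ v i k :=
  ((hv.lt_pow_iff hd (Nat.le_add_left 1 i) i).1 ((Nat.lt_succ_self i).trans_le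
    (Nat.le_self_pow (Nat.one_le_iff_ne_zero.1 hd) _)) k).1

theorem IsGridSequence.exists_apply_eq_add_one (hv : IsGridSequence v) (y : Fin d → ℕ) :
    ∃ i, ∀ k, v i k = y k + 1 := by
  have hy : (fun k => y k + 1) ∈ v '' {i | i < (Finset.univ.sup y + 1) ^ d} := by
    rw [hv _ (Nat.le_add_left 1 _)]
    exact fun k =>
      ⟨Nat.le_add_left 1 _, Nat.add_le_add_right (Finset.le_sup (Finset.mem_univ k)) 1⟩
  obtain ⟨i, -, hi⟩ := hy
  exact ⟨i, congrFun hi⟩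

theorem IsGridSequence.exists_isBoxEnumeration (hd : 1 ≤ d) (hv : IsGridSequence v) :
    ∃ e : (Fin d → ℕ) ≃ ℕ, IsBoxEnumeration e ∧ ∀ y k, v (e y) k = y k + 1 := by
  choose f hf using hv.exists_apply_eq_add_one
  have hbij : Function.Bijective f := by
    refine ⟨fun y y' h => funext fun k => ?_, fun i => ⟨fun k => v i k - 1, ?_⟩⟩
    · have hfk := hf y k
      rw [h, hf] at hfk
      exact (Nat.add_right_cancel hfk).symm
    · refine hv.injective hd (funext fun k => ?_)
      rw [hf, Nat.sub_add_cancel (hv.one_le_apply hd i k)]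
  refine ⟨Equiv.ofBijective f hbij, fun N y => ?_, hf⟩
  rw [Equiv.ofBijective_apply]
  rcases Nat.eq_zero_or_pos N with rfl | hN
  · have : Nonempty (Fin d) := ⟨⟨0, hd⟩⟩
    simp [zero_pow (Nat.one_le_iff_ne_zero.1 hd)]
  · simp only [hv.lt_pow_iff hd hN, hf]
    exact forall_congr' fun k => by omega

theorem IsBoxEnumeration.exists_equiv (he : IsBoxEnumeration e) (N : ℕ) :
    ∃ f : (Fin d → Fin N) ≃ Fin (N ^ d), ∀ l, (f l : ℕ) = e fun k => l k := by
  let f : (Fin d → Fin N) → Fin (N ^ d) := fun l =>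
    ⟨e fun k => l k, (he N _).2 fun k => (l k).2⟩
  refine ⟨Equiv.ofBijective f ⟨fun l l' h => funext fun k => Fin.ext ?_, fun i => ?_⟩,
    fun l => rfl⟩
  · exact congrFun (e.injective (Fin.ext_iff.1 h)) k
  · have hlt : ∀ k, e.symm i k < N := (he N _).1 (by rw [e.apply_symm_apply]; exact i.2)
    exact ⟨fun k => ⟨e.symm i k, hlt k⟩, Fin.ext (e.apply_symm_apply _)⟩

/-- The index of the point at position `l` of the `m`-th block of side `L`, when both the points
and the blocks are enumerated by `e`. -/
def blockIndex (e : (Fin d → ℕ) ≃ ℕ) {L : ℕ} (m : ℕ) (l : Fin d → Fin L) : ℕ :=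
  e fun i => L * e.symm m i + l i

theorem blockIndex_injective (e : (Fin d → ℕ) ≃ ℕ) (L : ℕ) :
    Function.Injective fun q : ℕ × (Fin d → Fin L) => blockIndex e q.1 q.2 := by
  intro q q' h
  have hcoord : ∀ i, e.symm q.1 i = e.symm q'.1 i ∧ (q.2 i : ℕ) = q'.2 i := fun i =>
    eq_and_eq_of_mul_add_eq (q.2 i).2 (q'.2 i).2 (congrFun (e.injective h) i)
  exact Prod.ext (e.symm.injective (funext fun i => (hcoord i).1))
    (funext fun i => Fin.ext (hcoord i).2)

end BoxEnumeration

section PointDeletion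

variable {d p : ℕ} {a b : ℝ} {K : (Fin p → ℝ) → EuclideanSpace ℝ (Fin d) → ℝ}

theorem sum_cross_bool_le {s : ℝ} (hs : 0 < s) {ι : Type*} [Fintype ι] (π : ι → Bool)
    {u : ι → Fin d → ℤ} (hu : Function.Injective u) :
    ∑ i, ∑ j, (if π i = π j then 0 else decayProfile d s (u i - u j))
      ≤ 2 * (∑' w : Fin d → ℤ, decayProfile d s w) * Fintype.card {i // π i = false} := by
  set G := ∑' w : Fin d → ℤ, decayProfile d s w
  have hsplit : ∀ i j, (if π i = π j then 0 else decayProfile d s (u i - u j))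
      ≤ (if π i = false then decayProfile d s (u i - u j) else 0)
        + if π j = false then decayProfile d s (u i - u j) else 0 := fun i j => by
    have hpos := (decayProfile_pos hs (u i - u j)).le
    cases π i <;> cases π j <;> simp [hpos]
  have hcount : ∑ i, (if π i = false then G else 0) = G * Fintype.card {i // π i = false} := by
    rw [← Finset.sum_filter, Finset.sum_const, nsmul_eq_mul, mul_comm, Fintype.card_subtype]
  have hrow : ∑ i, ∑ j, (if π i = false then decayProfile d s (u i - u j) else 0)
      ≤ G * Fintype.card {i // π i = false} := by
    refine (Finset.sum_le_sum fun i _ => ?_).trans_eq hcount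
    split_ifs
    exacts [sum_decayProfile_sub_left_le hs hu _, Finset.sum_const_zero.le]
  have hcol : ∑ i, ∑ j, (if π j = false then decayProfile d s (u i - u j) else 0)
      ≤ G * Fintype.card {i // π i = false} := by
    rw [Finset.sum_comm]
    refine (Finset.sum_le_sum fun j _ => ?_).trans_eq hcount
    split_ifs
    exacts [sum_decayProfile_sub_right_le hs hu _, Finset.sum_const_zero.le]
  refine (Finset.sum_le_sum fun i _ => Finset.sum_le_sum fun j _ => hsplit i j).trans ?_
  simp only [Finset.sum_add_distrib]
  linarith

theorem ModelCondition.exists_abs_covTrace_sub_restrict_le (hK : ModelCondition a b K) {ε : ℝ}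
    (hε : ε ∈ Set.Ico (0 : ℝ) (1 / 2)) (w : List (FactorLabel p)) :
    ∃ B : ℝ, 0 ≤ B ∧ ∀ θ ∈ paramSet p a b, ∀ {ι : Type u} [Fintype ι] [DecidableEq ι]
      (π : ι → Bool) {u : ι → Fin d → ℤ} {x : ι → EuclideanSpace ℝ (Fin d)},
      Function.Injective u → (∀ i k, |x i k| ≤ 1) →
      |covTrace a b K ε θ w u x
        - covTrace a b K ε θ w (fun i : {i // π i = true} => u i) (fun i => x i)|
      ≤ B * Fintype.card {i // π i = false} := by
  have hs : 0 < 1 - 2 * ε := by linarith [hε.2]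
  obtain ⟨B, hB, hbound⟩ := hK.exists_abs_covTrace_le.{u} hε w
  obtain ⟨D, hD, hsplit⟩ := hK.exists_abs_covTrace_sub_sum_fibre_le.{u, 0} hε w
  refine ⟨D * (2 * ∑' w : Fin d → ℤ, decayProfile d (1 - 2 * ε) w) + B,
    add_nonneg (mul_nonneg hD (mul_nonneg zero_le_two (tsum_decayProfile_pos hs).le)) hB,
    fun θ hθ ι _ _ π u x hu hx => ?_⟩
  have hcut := (hsplit θ hθ π hu hx).trans
    (mul_le_mul_of_nonneg_left (sum_cross_bool_le hs π hu) hD)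
  rw [Fintype.sum_bool, ← sub_sub] at hcut
  have hdeleted := hbound θ hθ (u := fun i : {i // π i = false} => u i) (x := fun i => x i)
    (hu.comp Subtype.val_injective) fun i => hx i
  linarith [(abs_sub_abs_le_abs_sub _ _).trans hcut]

theorem card_subtype_decide_val_lt_eq_false (m n : ℕ) :
    Fintype.card {i : Fin n // decide ((i : ℕ) < m) = false} = n - m := by
  have hcompl := Finset.card_filter_add_card_filter_not (s := (Finset.univ : Finset (Fin n)))
    (fun i : Fin n => (i : ℕ) < m)
  rw [Fin.card_filter_val_lt, Finset.card_univ, Fintype.card_fin] at hcompl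
  simp only [decide_eq_false_iff_not, Fintype.card_subtype]
  omega

theorem ModelCondition.exists_abs_covTrace_sub_le (hK : ModelCondition a b K) {ε : ℝ}
    (hε : ε ∈ Set.Ico (0 : ℝ) (1 / 2)) (w : List (FactorLabel p)) :
    ∃ B : ℝ, ∀ θ ∈ paramSet p a b, ∀ {u : ℕ → Fin d → ℤ} {x : ℕ → EuclideanSpace ℝ (Fin d)},
      Function.Injective u → (∀ i k, |x i k| ≤ 1) → ∀ m n : ℕ, m ≤ n →
      |covTrace a b K ε θ w (fun i : Fin n => u i) (fun i => x i)
        - covTrace a b K ε θ w (fun i : Fin m => u i) (fun i => x i)| ≤ B * (n - m) := by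
  obtain ⟨B, -, hB⟩ := hK.exists_abs_covTrace_sub_restrict_le hε w
  refine ⟨B, fun θ hθ u x hu hx m n hmn => ?_⟩
  let π : Fin n → Bool := fun i => decide ((i : ℕ) < m)
  let f : Fin m ≃ {i : Fin n // π i = true} :=
    { toFun := fun i => ⟨Fin.castLE hmn i, decide_eq_true i.2⟩
      invFun := fun i => ⟨i.1, of_decide_eq_true i.2⟩
      left_inv := fun i => rfl
      right_inv := fun i => rfl }
  have hrestrict := hB θ hθ π (hu.comp Fin.val_injective) fun i : Fin n => hx i
  rw [← covTrace_comp_equiv ε θ w _ _ f, card_subtype_decide_val_lt_eq_false,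
    Nat.cast_sub hmn] at hrestrict
  exact hrestrict

end PointDeletion

section Blocks

variable {d p : ℕ} {a b : ℝ} {K : (Fin p → ℝ) → EuclideanSpace ℝ (Fin d) → ℝ}

/-- The trace of the product of factors described by `w`, for the box `{0, ..., L - 1}^d` perturbed
by `y`. -/
def blockTrace (a b : ℝ) (K : (Fin p → ℝ) → EuclideanSpace ℝ (Fin d) → ℝ) (ε : ℝ)
    (θ : Fin p → ℝ) (w : List (FactorLabel p)) (L : ℕ)
    (y : (Fin d → Fin L) → EuclideanSpace ℝ (Fin d)) : ℝ :=
  covTrace a b K ε θ w (fun l k => ((l k : ℕ) : ℤ)) y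

theorem ModelCondition.exists_abs_blockTrace_le (hK : ModelCondition a b K) {ε : ℝ}
    (hε : ε ∈ Set.Ico (0 : ℝ) (1 / 2)) (w : List (FactorLabel p)) :
    ∃ B : ℝ, ∀ θ ∈ paramSet p a b, ∀ (L : ℕ) {y : (Fin d → Fin L) → EuclideanSpace ℝ (Fin d)},
      (∀ l k, |y l k| ≤ 1) → |blockTrace a b K ε θ w L y| ≤ B * (L : ℝ) ^ d := by
  obtain ⟨B, -, hB⟩ := hK.exists_abs_covTrace_le hε w
  refine ⟨B, fun θ hθ L y hy => ?_⟩
  have hinj : Function.Injective fun (l : Fin d → Fin L) (k : Fin d) => ((l k : ℕ) : ℤ) :=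
    fun l l' h => funext fun k => Fin.ext (Int.ofNat.inj (congrFun h k))
  simpa only [blockTrace, Fintype.card_fun, Fintype.card_fin, Nat.cast_pow] using hB θ hθ hinj hy

theorem covTrace_boxPoint_fibre (ε : ℝ) (θ : Fin p → ℝ) (w : List (FactorLabel p)) {k L : ℕ}
    (x : (Fin d → Fin k) × (Fin d → Fin L) → EuclideanSpace ℝ (Fin d)) (β : Fin d → Fin k) :
    covTrace a b K ε θ w (fun q : {q : (Fin d → Fin k) × (Fin d → Fin L) // q.1 = β} =>
      boxPoint q.1) (fun q => x q) = blockTrace a b K ε θ w L fun l => x (β, l) := by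
  let σ : (Fin d → Fin L) ≃ {q : (Fin d → Fin k) × (Fin d → Fin L) // q.1 = β} :=
    { toFun := fun l => ⟨(β, l), rfl⟩
      invFun := fun q => q.1.2
      left_inv := fun l => rfl
      right_inv := by rintro ⟨⟨β', l⟩, rfl⟩; rfl }
  rw [← covTrace_comp_equiv ε θ w _ _ σ, blockTrace,
    ← covTrace_add_const ε θ w (fun (l : Fin d → Fin L) i => ((l i : ℕ) : ℤ)) _
      (fun i => L * ((β i : ℕ) : ℤ))]
  congr 1
  funext l i
  exact add_comm _ _

theorem sum_range_blockTrace_eq_sum_covTrace_fibre (ε : ℝ) (θ : Fin p → ℝ)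
    (w : List (FactorLabel p)) {e : (Fin d → ℕ) ≃ ℕ} (he : IsBoxEnumeration e)
    (x : ℕ → EuclideanSpace ℝ (Fin d)) (k L : ℕ) :
    ∑ m ∈ Finset.range (k ^ d), blockTrace a b K ε θ w L (fun l => x (blockIndex e m l))
      = ∑ β : Fin d → Fin k, covTrace a b K ε θ w
        (fun q : {q : (Fin d → Fin k) × (Fin d → Fin L) // q.1 = β} => boxPoint q.1)
        (fun q => x (e fun i => L * q.1.1 i + q.1.2 i)) := by
  obtain ⟨f, hf⟩ := he.exists_equiv k
  rw [Finset.sum_range fun m => blockTrace a b K ε θ w L fun l => x (blockIndex e m l),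
    ← f.sum_comp]
  refine Finset.sum_congr rfl fun β _ => ?_
  rw [covTrace_boxPoint_fibre ε θ w (fun q => x (e fun i => L * q.1 i + q.2 i)) β]
  simp only [blockIndex, hf, Equiv.symm_apply_apply]

theorem covTrace_intGrid_eq_covTrace_boxPoint (ε : ℝ) (θ : Fin p → ℝ) (w : List (FactorLabel p))
    {v : ℕ → Fin d → ℕ} {e : (Fin d → ℕ) ≃ ℕ} (he : IsBoxEnumeration e)
    (hve : ∀ y k, v (e y) k = y k + 1) (x : ℕ → EuclideanSpace ℝ (Fin d)) (k L : ℕ) :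
    covTrace a b K ε θ w (fun i : Fin ((k * L) ^ d) => intGrid v i) (fun i => x i)
      = covTrace a b K ε θ w boxPoint
        (fun q : (Fin d → Fin k) × (Fin d → Fin L) => x (e fun i => L * q.1 i + q.2 i)) := by
  obtain ⟨g, hg⟩ := he.exists_equiv (k * L)
  let c : (Fin d → Fin k) × (Fin d → Fin L) ≃ (Fin d → Fin (k * L)) :=
    (Equiv.arrowProdEquivProdArrow _ _ _).symm.trans (Equiv.piCongrRight fun _ => finProdFinEquiv)
  have hc : ∀ q i, ((c q i : Fin (k * L)) : ℕ) = L * q.1 i + q.2 i := fun q i => add_comm _ _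
  have hgc : ∀ q, (g (c q) : ℕ) = e fun i => L * q.1 i + q.2 i := fun q => by
    simp only [hg, hc]
  rw [← covTrace_comp_equiv ε θ w _ _ (c.trans g), ← covTrace_add_const ε θ w boxPoint _ 1]
  congr 1
  · funext q i
    simp only [Function.comp_apply, Equiv.trans_apply, intGrid, hgc, hve, boxPoint, Pi.add_apply,
      Pi.one_apply, Nat.cast_add, Nat.cast_mul, Nat.cast_one]
  · funext q
    simp only [Function.comp_apply, Equiv.trans_apply, hgc]

theorem ModelCondition.exists_abs_covTrace_sub_sum_blockTrace_le
    (hK : ModelCondition a b K) {ε : ℝ} (hε : ε ∈ Set.Ico (0 : ℝ) (1 / 2))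
    (w : List (FactorLabel p)) :
    ∃ B : ℝ, 0 ≤ B ∧ ∀ θ ∈ paramSet p a b, ∀ {v : ℕ → Fin d → ℕ} {e : (Fin d → ℕ) ≃ ℕ},
      IsBoxEnumeration e → (∀ y k, v (e y) k = y k + 1) →
      ∀ {x : ℕ → EuclideanSpace ℝ (Fin d)}, (∀ i k, |x i k| ≤ 1) → ∀ k L : ℕ, 0 < L →
      |covTrace a b K ε θ w (fun i : Fin ((k * L) ^ d) => intGrid v i) (fun i => x i)
        - ∑ m ∈ Finset.range (k ^ d), blockTrace a b K ε θ w L (fun l => x (blockIndex e m l))|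
      ≤ B * boundaryLoss d (1 - 2 * ε) L * ((k * L : ℕ) : ℝ) ^ d := by
  have hs : 0 < 1 - 2 * ε := by linarith [hε.2]
  obtain ⟨B, hB, hsplit⟩ := hK.exists_abs_covTrace_sub_sum_fibre_le.{0, 0} hε w
  refine ⟨B, hB, fun θ hθ v e he hve x hx k L hL => ?_⟩
  rw [covTrace_intGrid_eq_covTrace_boxPoint ε θ w he hve,
    sum_range_blockTrace_eq_sum_covTrace_fibre ε θ w he, mul_assoc, mul_comm (boundaryLoss _ _ _)]
  exact (hsplit θ hθ Prod.fst boxPoint_injective fun q => hx _).trans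
    (mul_le_mul_of_nonneg_left (sum_cross_boxPoint_le hs hL) hB)

end Blocks

section Interpolation

variable {d L : ℕ}

/-- The largest `k` for which a box of side `k L` in dimension `d` has at most `n` points. -/
def blocksPerSide (d L n : ℕ) : ℕ :=
  Nat.findGreatest (fun k => (k * L) ^ d ≤ n) n

theorem blocksPerSide_mul_pow_le (hd : d ≠ 0) (L n : ℕ) : (blocksPerSide d L n * L) ^ d ≤ n :=
  Nat.findGreatest_spec (P := fun k => (k * L) ^ d ≤ n) (Nat.zero_le n)
    (by simp only [zero_mul, zero_pow hd, Nat.zero_le])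

theorem lt_blocksPerSide_add_one_mul_pow (hd : d ≠ 0) (hL : 0 < L) (n : ℕ) :
    n < ((blocksPerSide d L n + 1) * L) ^ d := by
  by_contra! h
  have hle : blocksPerSide d L n + 1 ≤ n :=
    (Nat.le_mul_of_pos_right _ hL).trans ((Nat.le_self_pow hd _).trans h)
  exact Nat.not_succ_le_self _ (Nat.le_findGreatest (P := fun k => (k * L) ^ d ≤ n) hle h)

theorem tendsto_blocksPerSide (d L : ℕ) : Tendsto (blocksPerSide d L) atTop atTop := by
  refine tendsto_atTop.2 fun R => ?_
  filter_upwards [eventually_ge_atTop (R + (R * L) ^ d)] with n hn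
  exact Nat.le_findGreatest (P := fun k => (k * L) ^ d ≤ n) (by omega) (by omega)

theorem tendsto_blocksPerSide_mul_pow_div (hd : d ≠ 0) (hL : 0 < L) :
    Tendsto (fun n : ℕ => ((blocksPerSide d L n * L : ℕ) : ℝ) ^ d / n) atTop (𝓝 1) := by
  have hlower : Tendsto (fun n : ℕ => ((blocksPerSide d L n : ℝ) / (blocksPerSide d L n + 1)) ^ d)
      atTop (𝓝 1) := by
    simpa only [one_pow, Function.comp_def] using
      ((tendsto_natCast_div_add_atTop (1 : ℝ)).comp (tendsto_blocksPerSide d L)).pow d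
  refine tendsto_of_tendsto_of_tendsto_of_le_of_le' hlower tendsto_const_nhds ?_ ?_
  · filter_upwards [eventually_gt_atTop 0] with n hn
    have hle : (n : ℝ) ≤ ((blocksPerSide d L n + 1) * L) ^ d := by
      exact_mod_cast (lt_blocksPerSide_add_one_mul_pow hd hL n).le
    rw [div_pow, div_le_div_iff₀ (by positivity) (Nat.cast_pos.2 hn), Nat.cast_mul, mul_pow,
      mul_assoc, ← mul_pow, mul_comm (L : ℝ)]
    gcongr
  · filter_upwards with n
    refine div_le_one_of_le₀ ?_ (Nat.cast_nonneg n)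
    exact_mod_cast blocksPerSide_mul_pow_le hd L n

theorem abs_div_sub_div_le {s t c : ℝ} {n : ℕ} (hn : 0 < n) (h : |s - t| ≤ c * n) :
    |s / n - t / n| ≤ c := by
  have hn' : (0 : ℝ) < n := Nat.cast_pos.2 hn
  rwa [← sub_div, abs_div, abs_of_pos hn', div_le_iff₀ hn']

theorem eventually_abs_div_sub_le (hd : d ≠ 0) (hL : 0 < L) {T A : ℕ → ℝ} {B ρ M η : ℝ}
    (hT : ∀ m n, m ≤ n → |T n - T m| ≤ B * (n - m)) (hρ : 0 ≤ ρ)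
    (hTA : ∀ k : ℕ, |T ((k * L) ^ d) - A k| ≤ ρ * ((k * L : ℕ) : ℝ) ^ d)
    (hA : Tendsto (fun k : ℕ => A k / ((k * L : ℕ) : ℝ) ^ d) atTop (𝓝 M)) (hη : 0 < η) :
    ∀ᶠ n : ℕ in atTop, |T n / n - M| ≤ ρ + η := by
  let r := blocksPerSide d L
  have hratio : Tendsto (fun n : ℕ => ((r n * L : ℕ) : ℝ) ^ d / n) atTop (𝓝 1) :=
    tendsto_blocksPerSide_mul_pow_div hd hL
  have hrest : Tendsto (fun n : ℕ => B * (1 - ((r n * L : ℕ) : ℝ) ^ d / n)) atTop (𝓝 0) := by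
    simpa only [sub_self, mul_zero] using (hratio.const_sub 1).const_mul B
  have hblocks : Tendsto (fun n : ℕ => A (r n) / n) atTop (𝓝 M) := by
    refine ((mul_one M) ▸ (hA.comp (tendsto_blocksPerSide d L)).mul hratio).congr' ?_
    filter_upwards [(tendsto_blocksPerSide d L).eventually_gt_atTop 0] with n hn
    have : (0 : ℝ) < ((r n * L : ℕ) : ℝ) := Nat.cast_pos.2 (Nat.mul_pos hn hL)
    exact div_mul_div_cancel₀ (by positivity)
  filter_upwards [hrest.eventually (ge_mem_nhds (half_pos hη)),
    Metric.tendsto_nhds.1 hblocks (η / 2) (half_pos hη), eventually_gt_atTop 0]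
    with n hrest_n hblocks_n hn
  have hle : (r n * L) ^ d ≤ n := blocksPerSide_mul_pow_le hd L n
  have htail : |T n / n - T ((r n * L) ^ d) / n| ≤ η / 2 := by
    refine (abs_div_sub_div_le hn ((hT _ n hle).trans_eq ?_)).trans hrest_n
    have : (n : ℝ) ≠ 0 := Nat.cast_ne_zero.2 hn.ne'
    push_cast
    field_simp
  have hbox : |T ((r n * L) ^ d) / n - A (r n) / n| ≤ ρ :=
    abs_div_sub_div_le hn ((hTA (r n)).trans
      (mul_le_mul_of_nonneg_left (by exact_mod_cast hle) hρ))
  rw [Real.dist_eq] at hblocks_n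
  have htriangle := (abs_sub_le (T n / n) (T ((r n * L) ^ d) / n) M).trans
    (add_le_add_right (abs_sub_le _ (A (r n) / n) M) _)
  linarith

end Interpolation

section CovarianceMeasurability

variable {d p : ℕ} {a b : ℝ} {K : (Fin p → ℝ) → EuclideanSpace ℝ (Fin d) → ℝ} {θ : Fin p → ℝ}

theorem continuous_cosTransform {h : EuclideanSpace ℝ (Fin d) → ℝ} (hh : Integrable h) :
    Continuous (cosTransform h) := by
  refine continuous_of_dominated (bound := fun f => ‖h f‖)
    (fun t => (integrable_mul_cos hh t).aestronglyMeasurable) (fun t => ?_) hh.norm ?_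
  · refine Eventually.of_forall fun f => ?_
    rw [norm_mul]
    exact mul_le_of_le_one_right (norm_nonneg _) (Real.abs_cos_le_one _)
  · exact Eventually.of_forall fun f => by fun_prop

theorem measurable_derivWithin_of_forall_differentiableWithinAt {α : Type*} [MeasurableSpace α]
    {g : ℝ → α → ℝ} {s : Set ℝ} {r : ℝ} (hr : r ∈ s) (hs : UniqueDiffWithinAt ℝ s r)
    (hmeas : ∀ q ∈ s, Measurable (g q))
    (hdiff : ∀ t, DifferentiableWithinAt ℝ (fun q => g q t) s r) :
    Measurable fun t => derivWithin (fun q => g q t) s r := by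
  have : (𝓝[s \ {r}] r).NeBot :=
    accPt_principal_iff_nhdsWithin.1 (uniqueDiffWithinAt_iff_accPt.1 hs)
  have : (comap ((↑) : s → ℝ) (𝓝[s \ {r}] r)).NeBot :=
    comap_coe_neBot_of_le_principal (inf_le_right.trans (principal_mono.2 Set.sdiff_subset))
  refine measurable_of_tendsto_metrizable' (comap ((↑) : s → ℝ) (𝓝[s \ {r}] r))
    (f := fun (q : s) t => slope (fun q => g q t) r q) (fun q => ?_) (tendsto_pi_nhds.2 fun t =>
      (hasDerivWithinAt_iff_tendsto_slope.1 (hdiff t).hasDerivWithinAt).comp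
        (tendsto_comap (f := ((↑) : s → ℝ))))
  simp only [slope_def_field]
  exact ((hmeas q q.2).sub (hmeas r hr)).div_const _

theorem update_mem_paramSet (hθ : θ ∈ paramSet p a b) (i : Fin p) {r : ℝ}
    (hr : r ∈ Set.Icc a b) : Function.update θ i r ∈ paramSet p a b := fun j => by
  rcases eq_or_ne j i with rfl | h
  · rwa [Function.update_self]
  · rw [Function.update_of_ne h]
    exact hθ j

theorem ModelCondition.differentiableWithinAt_iterPartial_update (hK : ModelCondition a b K)
    {I : List (Fin p)} (hI : I.length ≤ 2) (hθ : θ ∈ paramSet p a b) (i : Fin p)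
    (t : EuclideanSpace ℝ (Fin d)) :
    DifferentiableWithinAt ℝ
      (fun s => iterPartial a b I (fun θ' => K θ' t) (Function.update θ i s)) (Set.Icc a b)
      (θ i) :=
  (hK.differentiable I hI t _ (update_mem_paramSet hθ i (hθ i))).comp (θ i)
    (hasDerivAt_update θ i (θ i)).differentiableAt.differentiableWithinAt
    fun _ hs => update_mem_paramSet hθ i hs

theorem ModelCondition.measurable_iterPartial (hab : a < b) (hK : ModelCondition a b K)
    {I : List (Fin p)} (hI : I.length ≤ 3) (hθ : θ ∈ paramSet p a b) :
    Measurable fun t => iterPartial a b I (fun θ' => K θ' t) θ := by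
  induction I generalizing θ with
  | nil =>
    have hcos : (fun t => iterPartial a b [] (fun θ' => K θ' t) θ)
        = cosTransform fun f => (fourierHat (K θ) f).re :=
      funext fun t => hK.eq_cosTransform hθ t
    rw [hcos]
    exact (continuous_cosTransform (hK.integrable_hat θ hθ).re).measurable
  | cons i I ih =>
    have hI' : I.length ≤ 2 := Nat.le_of_succ_le_succ hI
    exact measurable_derivWithin_of_forall_differentiableWithinAt (hθ i)
      (uniqueDiffOn_Icc hab (θ i) (hθ i))
      (fun r hr => ih (hI'.trans (Nat.le_succ 2)) (update_mem_paramSet hθ i hr))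
      (hK.differentiableWithinAt_iterPartial_update hI' hθ i)

theorem ModelCondition.measurable_covTrace (hab : a < b) (hK : ModelCondition a b K)
    (hθ : θ ∈ paramSet p a b) (ε : ℝ) (w : List (FactorLabel p)) {ι : Type*}
    [Fintype ι] [DecidableEq ι] (u : ι → Fin d → ℤ) :
    Measurable fun x : ι → EuclideanSpace ℝ (Fin d) => covTrace a b K ε θ w u x := by
  refine measurable_trace_wordEval (fun I hI i j => ?_) w
  refine (hK.measurable_iterPartial hab hI hθ).comp ?_
  unfold gridPoint
  fun_prop

end CovarianceMeasurability

section BlockLaw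

variable {Ω : Type*} [MeasurableSpace Ω] {P : Measure Ω} {E : Type*} [MeasurableSpace E]
  {μ : Measure E} {X : ℕ → Ω → E} {Λ : Type*}

theorem indepFun_reindex_of_disjoint_range [Finite Λ] (hX : ∀ i, Measurable (X i))
    (hind : iIndepFun X P) {f g : Λ → ℕ} (hfg : ∀ l l', f l ≠ g l') :
    IndepFun (fun ω l => X (f l) ω) (fun ω l => X (g l) ω) P := by
  classical
  have := Fintype.ofFinite Λ
  have hdisj : Disjoint (Finset.univ.image f) (Finset.univ.image g) := by
    simp only [Finset.disjoint_left, Finset.mem_image, Finset.mem_univ, true_and]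
    rintro _ ⟨l, rfl⟩ ⟨l', h⟩
    exact hfg l l' h.symm
  have hread : ∀ h : Λ → ℕ, Measurable fun (z : Finset.univ.image h → E) (l : Λ) =>
      z ⟨h l, Finset.mem_image_of_mem h (Finset.mem_univ l)⟩ := fun h =>
    measurable_pi_lambda _ fun l => measurable_pi_apply _
  exact (hind.indepFun_finset _ _ hdisj hX).comp (hread f) (hread g)

variable [IsProbabilityMeasure P]

theorem measurePreserving_reindex_pi [Fintype Λ] (hX : ∀ i, Measurable (X i))
    (hlaw : ∀ i, P.map (X i) = μ) (hind : iIndepFun X P) {f : Λ → ℕ}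
    (hf : Function.Injective f) :
    MeasurePreserving (fun ω l => X (f l) ω) P (Measure.pi fun _ : Λ => μ) := by
  refine ⟨measurable_pi_lambda _ fun l => hX _, ?_⟩
  rw [(iIndepFun_iff_map_fun_eq_pi_map fun l => (hX (f l)).aemeasurable).1 (hind.precomp hf)]
  simp only [hlaw]

theorem ae_tendsto_block_average [Fintype Λ] (hX : ∀ i, Measurable (X i))
    (hlaw : ∀ i, P.map (X i) = μ) (hind : iIndepFun X P) {f : ℕ → Λ → ℕ}
    (hf : Function.Injective fun q : ℕ × Λ => f q.1 q.2) {φ : (Λ → E) → ℝ} (hφ : Measurable φ)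
    (hφ_int : Integrable φ (Measure.pi fun _ => μ)) :
    ∀ᵐ ω ∂P, Tendsto (fun n : ℕ => (∑ m ∈ Finset.range n, φ fun l => X (f m l) ω) / n) atTop
      (𝓝 (∫ y, φ y ∂Measure.pi fun _ => μ)) := by
  have hblock : ∀ m, MeasurePreserving (fun ω l => X (f m l) ω) P (Measure.pi fun _ : Λ => μ) :=
    fun m => measurePreserving_reindex_pi hX hlaw hind fun l l' h =>
      (Prod.mk.inj (hf (a₁ := (m, l)) (a₂ := (m, l')) h)).2
  rw [← (hblock 0).map_eq, integral_map (hblock 0).aemeasurable hφ.aestronglyMeasurable]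
  refine strong_law_ae_real (fun m ω => φ fun l => X (f m l) ω)
    ((hblock 0).integrable_comp_of_integrable hφ_int) (fun m m' hm => ?_) fun m => ?_
  · refine (indepFun_reindex_of_disjoint_range hX hind fun l l' h => hm ?_).comp hφ hφ
    exact (Prod.mk.inj (hf (a₁ := (m, l)) (a₂ := (m', l')) h)).1
  · exact (IdentDistrib.mk (hblock m).aemeasurable (hblock 0).aemeasurable
      ((hblock m).map_eq.trans (hblock 0).map_eq.symm)).comp hφ

end BlockLaw

section Limits

theorem cauchySeq_of_eventually_abs_sub_le {s M ρ : ℕ → ℝ} (hρ : Tendsto ρ atTop (𝓝 0))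
    (h : ∀ L : ℕ, 0 < L → ∀ η : ℝ, 0 < η → ∀ᶠ n in atTop, |s n - M L| ≤ ρ L + η) :
    CauchySeq M := by
  refine Metric.cauchySeq_iff'.2 fun δ hδ => ?_
  obtain ⟨N, hN⟩ := eventually_atTop.1
    ((hρ.eventually (gt_mem_nhds (by positivity : 0 < δ / 4))).and (eventually_gt_atTop 0))
  refine ⟨N, fun L hL => ?_⟩
  obtain ⟨n, hL_near, hN_near⟩ := ((h L (hN L hL).2 (δ / 8) (by positivity)).and
    (h N (hN N le_rfl).2 (δ / 8) (by positivity))).exists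
  rw [abs_sub_comm] at hL_near
  rw [Real.dist_eq]
  linarith [abs_sub_le (M L) (s n) (M N), (hN L hL).1, (hN N le_rfl).1]

theorem tendsto_limUnder_of_eventually_abs_sub_le {s M ρ : ℕ → ℝ} (hρ : Tendsto ρ atTop (𝓝 0))
    (h : ∀ L : ℕ, 0 < L → ∀ η : ℝ, 0 < η → ∀ᶠ n in atTop, |s n - M L| ≤ ρ L + η) :
    Tendsto s atTop (𝓝 (limUnder atTop M)) := by
  have hlim := (cauchySeq_of_eventually_abs_sub_le hρ h).tendsto_limUnder
  refine Metric.tendsto_nhds.2 fun δ hδ => ?_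
  obtain ⟨L, hρL, hML, hL⟩ := ((hρ.eventually (gt_mem_nhds (by positivity : 0 < δ / 4))).and
    ((Metric.tendsto_nhds.1 hlim (δ / 4) (by positivity)).and (eventually_gt_atTop 0))).exists
  filter_upwards [h L hL (δ / 4) (by positivity)] with n hn
  rw [Real.dist_eq] at hML ⊢
  linarith [abs_sub_le (s n) (M L) (limUnder atTop M)]

variable {Ω : Type*} [MeasurableSpace Ω] {P : Measure Ω} {Y : ℕ → Ω → ℝ} {S C : ℝ}

theorem tendsto_integral_sq_sub_of_ae_abs_le [IsFiniteMeasure P]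
    (hY : ∀ n, AEStronglyMeasurable (Y n) P) (hC : ∀ᵐ ω ∂P, ∀ n, |Y n ω| ≤ C)
    (hS : ∀ᵐ ω ∂P, Tendsto (fun n => Y n ω) atTop (𝓝 S)) :
    Tendsto (fun n => ∫ ω, (Y n ω - S) ^ 2 ∂P) atTop (𝓝 0) := by
  rw [← integral_zero Ω ℝ (μ := P)]
  refine tendsto_integral_of_dominated_convergence (fun _ => (C + |S|) ^ 2)
    (fun n => ((hY n).sub aestronglyMeasurable_const).pow 2) (integrable_const _) (fun n => ?_) ?_
  · filter_upwards [hC] with ω hω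
    rw [Real.norm_of_nonneg (sq_nonneg _), ← sq_abs (Y n ω - S)]
    exact pow_le_pow_left₀ (abs_nonneg _) ((abs_sub _ _).trans (add_le_add_left (hω n) _)) 2
  · filter_upwards [hS] with ω hω
    simpa only [sub_self, zero_pow two_ne_zero] using (hω.sub_const S).pow 2

theorem tendsto_eLpNorm_two_of_tendsto_integral_sq {Z : ℕ → Ω → ℝ} (hZ : ∀ n, MemLp (Z n) 2 P)
    (h : Tendsto (fun n => ∫ ω, Z n ω ^ 2 ∂P) atTop (𝓝 0)) :
    Tendsto (fun n => eLpNorm (Z n) 2 P) atTop (𝓝 0) := by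
  have hnorm : ∀ n, eLpNorm (Z n) 2 P = ENNReal.ofReal ((∫ ω, Z n ω ^ 2 ∂P) ^ (2 : ℝ)⁻¹) :=
    fun n => by
      simp [(hZ n).eLpNorm_eq_integral_rpow_norm two_ne_zero ENNReal.ofNat_ne_top]
  have hsqrt := h.rpow_const (p := (2 : ℝ)⁻¹) (Or.inr (by positivity))
  rw [Real.zero_rpow (by positivity)] at hsqrt
  simpa only [hnorm, ENNReal.ofReal_zero] using ENNReal.tendsto_ofReal hsqrt

theorem tendsto_variance_of_tendsto_integral_sq_sub [IsProbabilityMeasure P]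
    (hY : ∀ n, AEStronglyMeasurable (Y n) P)
    (h : Tendsto (fun n => ∫ ω, (Y n ω - S) ^ 2 ∂P) atTop (𝓝 0)) :
    Tendsto (fun n => variance (Y n) P) atTop (𝓝 0) := by
  refine squeeze_zero (fun n => variance_nonneg _ _) (fun n => ?_) h
  rw [← variance_sub_const (hY n) S]
  exact variance_le_expectation_sq ((hY n).sub aestronglyMeasurable_const)

end Limits

section NormalizedTrace

variable {d p : ℕ} {a b : ℝ} {K : (Fin p → ℝ) → EuclideanSpace ℝ (Fin d) → ℝ} {θ : Fin p → ℝ}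
  {ε : ℝ} {μ : Measure (EuclideanSpace ℝ (Fin d))}

theorem ModelCondition.exists_abs_normTrace_le (hd : 1 ≤ d) (hK : ModelCondition a b K)
    (hε : ε ∈ Set.Ico (0 : ℝ) (1 / 2)) (w : List (FactorLabel p)) :
    ∃ B : ℝ, ∀ θ ∈ paramSet p a b, ∀ v, IsGridSequence v → ∀ (n : ℕ)
      (x : Fin n → EuclideanSpace ℝ (Fin d)), (∀ i k, |x i k| ≤ 1) →
        |normTrace a b K v ε x θ w| ≤ B := by
  obtain ⟨B, hB, hbound⟩ := hK.exists_abs_covTrace_le hε w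
  refine ⟨B, fun θ hθ v hv n x hx => ?_⟩
  rw [normTrace_eq_covTrace_div, abs_div, Nat.abs_cast]
  refine div_le_of_le_mul₀ (Nat.cast_nonneg n) hB ?_
  have htrace := hbound θ hθ ((intGrid_injective (hv.injective hd)).comp Fin.val_injective) hx
  rw [Fintype.card_fin] at htrace
  exact htrace

theorem ModelCondition.measurable_normTrace (hab : a < b) (hK : ModelCondition a b K)
    (hθ : θ ∈ paramSet p a b) (w : List (FactorLabel p)) (v : ℕ → Fin d → ℕ) (n : ℕ) :
    Measurable fun x : Fin n → EuclideanSpace ℝ (Fin d) => normTrace a b K v ε x θ w := by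
  simp only [normTrace_eq_covTrace_div]
  exact (hK.measurable_covTrace hab hθ ε w _).div_const _

theorem ModelCondition.integrable_blockTrace [IsProbabilityMeasure μ] (hab : a < b)
    (hK : ModelCondition a b K) (hμ : ∀ᵐ x ∂μ, ∀ k, |x k| ≤ 1)
    (hε : ε ∈ Set.Ico (0 : ℝ) (1 / 2)) (hθ : θ ∈ paramSet p a b) (w : List (FactorLabel p))
    (L : ℕ) : Integrable (blockTrace a b K ε θ w L) (Measure.pi fun _ => μ) := by
  obtain ⟨B, hB⟩ := hK.exists_abs_blockTrace_le hε w
  refine Integrable.of_bound (hK.measurable_covTrace hab hθ ε w _).aestronglyMeasurable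
    (B * (L : ℝ) ^ d) ?_
  filter_upwards [ae_all_iff.2 fun l => (Measure.tendsto_eval_ae_ae (i := l)).eventually hμ]
    with y hy
  exact hB θ hθ L hy

/-- The mean of the normalized trace for the box `{0, ..., L - 1}^d` with perturbations of law `μ`.
Its limit as `L → ∞` is the almost sure limit of the normalized traces. -/
def meanBlockTrace (a b : ℝ) (K : (Fin p → ℝ) → EuclideanSpace ℝ (Fin d) → ℝ)
    (μ : Measure (EuclideanSpace ℝ (Fin d))) (ε : ℝ) (θ : Fin p → ℝ) (w : List (FactorLabel p))
    (L : ℕ) : ℝ :=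
  (∫ y, blockTrace a b K ε θ w L y ∂Measure.pi fun _ : Fin d → Fin L => μ) / (L : ℝ) ^ d

variable {Ω : Type*} [MeasurableSpace Ω] {P : Measure Ω}
  {X : ℕ → Ω → EuclideanSpace ℝ (Fin d)} {v : ℕ → Fin d → ℕ}

theorem ae_forall_abs_apply_le (hμ : ∀ᵐ x ∂μ, ∀ k, |x k| ≤ 1) (hX : ∀ i, Measurable (X i))
    (hlaw : ∀ i, P.map (X i) = μ) : ∀ᵐ ω ∂P, ∀ i k, |X i ω k| ≤ 1 :=
  ae_all_iff.2 fun i => ae_of_ae_map (hX i).aemeasurable ((hlaw i).symm ▸ hμ)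

theorem ModelCondition.ae_forall_abs_normTrace_le (hd : 1 ≤ d) (hK : ModelCondition a b K)
    (hμ : ∀ᵐ x ∂μ, ∀ k, |x k| ≤ 1) (hε : ε ∈ Set.Ico (0 : ℝ) (1 / 2))
    (hθ : θ ∈ paramSet p a b) (w : List (FactorLabel p)) (hv : IsGridSequence v)
    (hX : ∀ i, Measurable (X i)) (hlaw : ∀ i, P.map (X i) = μ) :
    ∃ B : ℝ, ∀ᵐ ω ∂P, ∀ n : ℕ, |normTrace a b K v ε (fun i : Fin n => X i ω) θ w| ≤ B := by
  obtain ⟨B, hB⟩ := hK.exists_abs_normTrace_le hd hε w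
  exact ⟨B, (ae_forall_abs_apply_le hμ hX hlaw).mono fun ω hω n => hB θ hθ v hv n _ fun i => hω i⟩

variable [IsProbabilityMeasure P]

theorem ModelCondition.ae_tendsto_sum_blockTrace_div (hd : 1 ≤ d) (hab : a < b)
    (hK : ModelCondition a b K) (hμ : ∀ᵐ x ∂μ, ∀ k, |x k| ≤ 1) (hε : ε ∈ Set.Ico (0 : ℝ) (1 / 2))
    (hθ : θ ∈ paramSet p a b) (w : List (FactorLabel p)) (hX : ∀ i, Measurable (X i))
    (hlaw : ∀ i, P.map (X i) = μ) (hind : iIndepFun X P) (e : (Fin d → ℕ) ≃ ℕ) (L : ℕ) :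
    ∀ᵐ ω ∂P, Tendsto (fun k : ℕ => (∑ m ∈ Finset.range (k ^ d),
      blockTrace a b K ε θ w L fun l => X (blockIndex e m l) ω) / ((k * L : ℕ) : ℝ) ^ d) atTop
      (𝓝 (meanBlockTrace a b K μ ε θ w L)) := by
  have : IsProbabilityMeasure μ := hlaw 0 ▸ Measure.isProbabilityMeasure_map (hX 0).aemeasurable
  filter_upwards [ae_tendsto_block_average hX hlaw hind (blockIndex_injective e L)
    (hK.measurable_covTrace hab hθ ε w _) (hK.integrable_blockTrace hab hμ hε hθ w L)]
    with ω hω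
  refine ((hω.comp (tendsto_pow_atTop (Nat.one_le_iff_ne_zero.1 hd))).div_const
    ((L : ℝ) ^ d)).congr fun k => ?_
  rw [Function.comp_apply, Nat.cast_mul, mul_pow, div_div, Nat.cast_pow]
  rfl

theorem ModelCondition.ae_tendsto_normTrace (hd : 1 ≤ d) (hab : a < b)
    (hK : ModelCondition a b K) (hμ : ∀ᵐ x ∂μ, ∀ k, |x k| ≤ 1)
    (hε : ε ∈ Set.Ico (0 : ℝ) (1 / 2)) (hθ : θ ∈ paramSet p a b) (w : List (FactorLabel p))
    (hv : IsGridSequence v) (hX : ∀ i, Measurable (X i)) (hlaw : ∀ i, P.map (X i) = μ)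
    (hind : iIndepFun X P) :
    ∀ᵐ ω ∂P, Tendsto (fun n : ℕ => normTrace a b K v ε (fun i : Fin n => X i ω) θ w) atTop
      (𝓝 (limUnder atTop (meanBlockTrace a b K μ ε θ w))) := by
  have hs : 0 < 1 - 2 * ε := by linarith [hε.2]
  obtain ⟨e, he, hve⟩ := hv.exists_isBoxEnumeration hd
  obtain ⟨B, hdelete⟩ := hK.exists_abs_covTrace_sub_le hε w
  obtain ⟨D, hD, hsplit⟩ := hK.exists_abs_covTrace_sub_sum_blockTrace_le hε w
  filter_upwards [ae_forall_abs_apply_le hμ hX hlaw,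
    ae_all_iff.2 (hK.ae_tendsto_sum_blockTrace_div hd hab hμ hε hθ w hX hlaw hind e)]
    with ω hω hblocks
  have hloss : Tendsto (fun L => D * boundaryLoss d (1 - 2 * ε) L) atTop (𝓝 0) := by
    simpa only [mul_zero] using (tendsto_boundaryLoss (d := d) hs).const_mul D
  refine tendsto_limUnder_of_eventually_abs_sub_le hloss fun L hL η hη => ?_
  simp only [normTrace_eq_covTrace_div]
  refine eventually_abs_div_sub_le (B := B) (Nat.one_le_iff_ne_zero.1 hd) hL
    (fun m n hmn => ?_) (mul_nonneg hD (boundaryLoss_nonneg hs L)) (fun k => ?_) (hblocks L) hη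
  · exact hdelete θ hθ (u := intGrid v) (x := fun i => X i ω)
      (intGrid_injective (hv.injective hd)) hω m n hmn
  · exact hsplit θ hθ he hve (x := fun i => X i ω) hω k L hL

end NormalizedTrace

end PerturbedGrid

end

theorem mainTheorem12_general {d p : ℕ} (hd : 1 ≤ d) (a b : ℝ) (hab : a < b)
    (K : (Fin p → ℝ) → EuclideanSpace ℝ (Fin d) → ℝ)
    (hK : PerturbedGrid.ModelCondition a b K)
    (μ : Measure (EuclideanSpace ℝ (Fin d))) (hμ : ∀ᵐ x ∂μ, ∀ k, |x k| ≤ 1) :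
    (∀ ε ∈ Set.Ico (0 : ℝ) (1 / 2), ∀ w : List (PerturbedGrid.FactorLabel p),
      ∃ C : ℝ, ∀ θ ∈ PerturbedGrid.paramSet p a b,
        ∀ v : ℕ → Fin d → ℕ, PerturbedGrid.IsGridSequence v →
        ∀ (n : ℕ) (x : Fin n → EuclideanSpace ℝ (Fin d)), (∀ i k, |x i k| ≤ 1) →
          ∀ j : ℕ, (Matrix.toEuclideanLin
            (PerturbedGrid.wordMatrix a b K v ε x θ w)).singularValues j ≤ C) ∧
    (∃ S : ℝ → (Fin p → ℝ) → List (PerturbedGrid.FactorLabel p) → ℝ,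
      ∀ ε ∈ Set.Ico (0 : ℝ) (1 / 2), ∀ θ ∈ PerturbedGrid.paramSet p a b,
      ∀ w : List (PerturbedGrid.FactorLabel p),
      ∀ v : ℕ → Fin d → ℕ, PerturbedGrid.IsGridSequence v →
      ∀ (Ω : Type*) [MeasurableSpace Ω] (P : Measure Ω) [IsProbabilityMeasure P]
        (X : ℕ → Ω → EuclideanSpace ℝ (Fin d)),
        (∀ i, Measurable (X i)) → (∀ i, P.map (X i) = μ) → iIndepFun X P →
        (∀ᵐ ω ∂P, Tendsto
          (fun n : ℕ => PerturbedGrid.normTrace a b K v ε (fun i : Fin n => X i ω) θ w)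
          atTop (𝓝 (S ε θ w))) ∧
        (∀ n : ℕ, MemLp
          (fun ω => PerturbedGrid.normTrace a b K v ε (fun i : Fin n => X i ω) θ w) 2 P) ∧
        Tendsto (fun n : ℕ => eLpNorm
          (fun ω => PerturbedGrid.normTrace a b K v ε (fun i : Fin n => X i ω) θ w - S ε θ w)
          2 P) atTop (𝓝 0) ∧
        Tendsto (fun n : ℕ => variance
          (fun ω => PerturbedGrid.normTrace a b K v ε (fun i : Fin n => X i ω) θ w) P)
          atTop (𝓝 0)) := by
  refine ⟨fun ε hε w => hK.exists_singularValues_wordMatrix_le hd hε w,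
    fun ε θ w => limUnder atTop (PerturbedGrid.meanBlockTrace a b K μ ε θ w),
    fun ε hε θ hθ w v hv Ω _ P _ X hX hlaw hind => ?_⟩
  have hlim := hK.ae_tendsto_normTrace hd hab hμ hε hθ w hv hX hlaw hind
  obtain ⟨B, hB⟩ := hK.ae_forall_abs_normTrace_le hd hμ hε hθ w hv hX hlaw
  have hmeas (n : ℕ) : AEStronglyMeasurable
      (fun ω => PerturbedGrid.normTrace a b K v ε (fun i : Fin n => X i ω) θ w) P :=
    ((hK.measurable_normTrace hab hθ w v n).comp
      (measurable_pi_lambda _ fun i => hX i)).aestronglyMeasurable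
  have hmem (n : ℕ) : MemLp
      (fun ω => PerturbedGrid.normTrace a b K v ε (fun i : Fin n => X i ω) θ w) 2 P :=
    MemLp.of_bound (hmeas n) B (hB.mono fun ω hω => hω n)
  have hsq := PerturbedGrid.tendsto_integral_sq_sub_of_ae_abs_le hmeas hB hlim
  exact ⟨hlim, hmem, PerturbedGrid.tendsto_eLpNorm_two_of_tendsto_integral_sq
    (fun n => (hmem n).sub (memLp_const _)) hsq,
    PerturbedGrid.tendsto_variance_of_tendsto_integral_sq_sub hmeas hsq⟩

theorem mainTheorem12 {d p : ℕ} (hd : 1 ≤ d) (a b : ℝ) (hab : a < b)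
    (K : (Fin p → ℝ) → EuclideanSpace ℝ (Fin d) → ℝ)
    (hK : PerturbedGrid.ModelCondition a b K)
    (μ : Measure (EuclideanSpace ℝ (Fin d))) (hμ : PerturbedGrid.IsPerturbationLaw μ) :
    (∀ v : ℕ → Fin d → ℕ, PerturbedGrid.IsGridSequence v →
      ∀ ε ∈ Set.Ico (0 : ℝ) (1 / 2), ∀ w : List (PerturbedGrid.FactorLabel p),
        ∃ C : ℝ, ∀ θ ∈ PerturbedGrid.paramSet p a b,
          PerturbedGrid.MemClass a b K v ε μ.support θ w →
          ∀ (n : ℕ) (x : Fin n → EuclideanSpace ℝ (Fin d)), (∀ i, x i ∈ μ.support) →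
            ∀ j : ℕ, (Matrix.toEuclideanLin
              (PerturbedGrid.wordMatrix a b K v ε x θ w)).singularValues j ≤ C) ∧
    (∃ S : ℝ → (Fin p → ℝ) → List (PerturbedGrid.FactorLabel p) → ℝ,
      ∀ ε ∈ Set.Ico (0 : ℝ) (1 / 2), ∀ θ ∈ PerturbedGrid.paramSet p a b,
      ∀ w : List (PerturbedGrid.FactorLabel p),
      ∀ v : ℕ → Fin d → ℕ, PerturbedGrid.IsGridSequence v →
      PerturbedGrid.MemClass a b K v ε μ.support θ w →
      ∀ (Ω : Type*) [MeasurableSpace Ω] (P : Measure Ω) [IsProbabilityMeasure P]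
        (X : ℕ → Ω → EuclideanSpace ℝ (Fin d)),
        (∀ i, Measurable (X i)) → (∀ i, P.map (X i) = μ) → iIndepFun X P →
        (∀ᵐ ω ∂P, Tendsto
          (fun n : ℕ => PerturbedGrid.normTrace a b K v ε (fun i : Fin n => X i ω) θ w)
          atTop (𝓝 (S ε θ w))) ∧
        (∀ n : ℕ, MemLp
          (fun ω => PerturbedGrid.normTrace a b K v ε (fun i : Fin n => X i ω) θ w) 2 P) ∧
        Tendsto (fun n : ℕ => eLpNorm
          (fun ω => PerturbedGrid.normTrace a b K v ε (fun i : Fin n => X i ω) θ w - S ε θ w)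
          2 P) atTop (𝓝 0) ∧
        Tendsto (fun n : ℕ => variance
          (fun ω => PerturbedGrid.normTrace a b K v ε (fun i : Fin n => X i ω) θ w) P)
          atTop (𝓝 0)) := by
  obtain ⟨hbound, S, hS⟩ := mainTheorem12_general hd a b hab K hK μ
    (mem_of_superset Measure.support_mem_ae hμ.support_subset)
  exact ⟨fun v hv ε hε w => (hbound ε hε w).imp fun C hC θ hθ _ n x hx => hC θ hθ v hv n x fun i =>
    hμ.support_subset _ (hx i), S, fun ε hε θ hθ w v hv _ => hS ε hε θ hθ w v hv⟩
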